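/- Let $m,d,e,k$ be positive integers with $e=\gcd(m,d)=\gcd(m,2d)$ and $2\le k\le \frac{m+e}{2e}$. Let $s=(s(i))_{i\in\mathbb Z/(2^m-1)}$ be a maximum-length binary sequence of length $2^m-1$, that is, a sequence over $\mathbb F_2$ that satisfies a linear recurrence of order $m$ over $\mathbb F_2$ and has least period $2^m-1$. For $1\le j\le k-1$ let $s_j$ be the circular decimation $s_j(i)=s(f_j i)$, where the system of decimation factors $(f_1,\dots,f_{k-1})$ is one of the following three: $f_j=2^{jd}+1$ for all $j$; or $f_j=2^{(2j-1)d}+1$ for all $j$; or $f_j=2^{(\frac{m+e}{2e}-j)d}+1$ for all $j$. Let $C$ be the $\mathbb F_2$-vector space generated by all circular shifts of $s,s_1,\dots,s_{k-1}$, and for $c=(c_0,\dots,c_{2^m-2})\in C$ let $\mathrm{DC}(c)=\sum_{i=0}^{2^m-2}(-1)^{c_i}$. Then \[ \#\{c\in C\mid \mathrm{DC}(c)=-1\}=2^{mk}-1-\sum_{u=0}^{k-2}(-1)^u2^{-e(u+1)^2}\bigl(2^{m(k-u)}-2^m\bigr)\prod_{j=0}^{u-1}\bigl(2^m-2^{e(2j+1)}\bigr).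 \] Moreover, \[ \#\{c\in C\mid \mathrm{DC}(c)=-1\}\approx 2^{mk}\Bigl(1-\sum_{u=0}^{k-2}(-1)^u2^{-e(u+1)^2}\Bigr) \] in the sense that the ratio of the two sides tends to $1$ as $m\to\infty$, uniformly in all admissible $d,e,k$, in the choice among the three systems of factors, and in $s$. -/

import Mathlib

namespace GoldType

/-- The standing numerical assumptions on the positive integers `m, d, e, k`:
`e = (m, d) = (m, 2d)` and `2 ≤ k ≤ (m + e) / (2e)`. -/
structure Parameters (m d e k : ℕ) : Prop where
  m_pos : 0 < m
  d_pos : 0 < d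
  gcd_eq : e = Nat.gcd m d
  gcd_two_eq : e = Nat.gcd m (2 * d)
  two_le : 2 ≤ k
  le_bound : 2 * e * k ≤ m + e

/-- Binary sequences of length `2 ^ m - 1`, with positions read modulo `2 ^ m - 1`. -/
abbrev BinSeq (m : ℕ) : Type := ZMod (2 ^ m - 1) → ZMod 2

/-- A maximum-length binary sequence of length `2 ^ m - 1`: it is the output of a linear feedback
shift register with `m` stages (a linear recurrence of order `m` over `𝔽₂`), and its least period
is the full length `2 ^ m - 1`. -/
def IsMaxLength (m : ℕ) (s : BinSeq m) : Prop :=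
  (∃ a : Fin m → ZMod 2, ∀ i : ZMod (2 ^ m - 1),
    s (i + (m : ZMod (2 ^ m - 1))) =
      ∑ j : Fin m, a j * s (i + ((j : ℕ) : ZMod (2 ^ m - 1)))) ∧
  ∀ t : ZMod (2 ^ m - 1), (∀ i, s (i + t) = s i) → t = 0

/-- The circular shift of a sequence by `t` positions. -/
def shift {m : ℕ} (t : ZMod (2 ^ m - 1)) (s : BinSeq m) : BinSeq m := fun i => s (i + t)

/-- The circular decimation of a sequence with decimation factor `f`. -/
def decimate {m : ℕ} (f : ℕ) (s : BinSeq m) : BinSeq m :=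
  fun i => s ((f : ZMod (2 ^ m - 1)) * i)

/-- The three admissible systems of decimation factors. -/
inductive System : Type
  | consecutive
  | odd
  | descending

/-- The `j`-th decimation factor, used for `1 ≤ j ≤ k - 1` only. Under `Parameters m d e k`, the
number `(m + e) / (2 * e)` is an exact quotient and exceeds every such `j`. -/
def System.factor (m d e : ℕ) : System → ℕ → ℕ
  | .consecutive, j => 2 ^ (j * d) + 1
  | .odd, j => 2 ^ ((2 * j - 1) * d) + 1
  | .descending, j => 2 ^ (((m + e) / (2 * e) - j) * d) + 1

/-- The Gold type code: the `𝔽₂`-space generated by all circular shifts of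
`s, s₁, …, s_{k-1}`, where `s_j` is the decimation of `s` by the `j`-th factor. -/
def code (m d e k : ℕ) (S : System) (s : BinSeq m) : Submodule (ZMod 2) (BinSeq m) :=
  Submodule.span (ZMod 2)
    ({c | ∃ t, c = shift t s} ∪
      {c | ∃ t j, 1 ≤ j ∧ j ≤ k - 1 ∧ c = shift t (decimate (S.factor m d e j) s)})

/-- The DC component `∑_{i=0}^{2^m-2} (-1)^{c_i}`. -/
def dc {m : ℕ} (c : BinSeq m) : ℤ :=
  ∑ i ∈ Finset.range (2 ^ m - 1), (-1 : ℤ) ^ (c (i : ZMod (2 ^ m - 1))).val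

/-- The number of balanced codewords, that is, those with DC component `-1`. -/
noncomputable def balancedCount (m d e k : ℕ) (S : System) (s : BinSeq m) : ℕ :=
  Set.ncard {c : BinSeq m | c ∈ code m d e k S s ∧ dc c = -1}

end GoldType

/-!
Write `s i = Tr (β * α ^ i)` with a primitive element `α` of the field `F` with `2 ^ m` elements.
The words of the code are then the restrictions to `Fˣ` of the functions `x ↦ Tr (Q x)`, where
`Q x = b₀ * x + ∑ j, b j * (x * J j x)` and the `J j` are automorphisms of `F` over a subfield `K`
with `q = 2 ^ e` elements, and a word is balanced if and only if the exponential sum of its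
function is zero. The polar form of `Tr ∘ Q` is `Tr (L x * y)` with `L` a linear combination over
`F` of consecutive powers of a generator of the Galois group, so for `b ≠ 0` its kernel has odd
dimension `2 * s + 1` with `s < k - 1`; the square of the sum is `2 ^ m * q ^ (2 * s + 1)` for a
fraction `q ^ (-(2 * s + 1))` of the coefficients `b₀`, and the sum is zero for the others.
It remains to average `1 / R`, with `R` the cardinality of the kernel, over all `b`. The same bound
on dimensions, applied to the linear relations dual to the polar forms, gives the average number of
linearly independent `r`-tuples in the kernel for `r < k`. This determines the average of every
polynomial of degree less than `k` in `R`, and the expansion of `1 / R` in powers of `q`-products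
terminates on the odd-dimensional kernels.
-/

namespace GoldType

open Finset Module

section QTransform

open Polynomial
open Lagrange (nodal)

variable {k : Type*} [Field k]

lemma nodal_comp_inv_mul {q : k} (hq : q ≠ 0) (a : ℕ → k) (n : ℕ) :
    (nodal (range n) a).comp (C q⁻¹ * X) =
      C (q⁻¹ ^ n) * nodal (range n) (fun j => q * a j) := by
  have factor_comp (j : ℕ) : (X - C (a j)).comp (C q⁻¹ * X) = C q⁻¹ * (X - C (q * a j)) := by
    simp only [sub_comp, X_comp, C_comp, mul_sub, ← C_mul, inv_mul_cancel_left₀ hq]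
  simp only [nodal, Polynomial.prod_comp, factor_comp, prod_mul_distrib, prod_const, card_range,
    C_pow]

lemma sub_one_mul_nodal_pow (q : k) (n : ℕ) :
    (X - 1) * nodal (range n) (fun j => q * q ^ j) = nodal (range (n + 1)) (q ^ ·) := by
  simp only [nodal, prod_range_succ', ← pow_succ', pow_zero, C_1, mul_comm]

lemma sub_one_mul_nodal_pow_odd (q : k) (n : ℕ) :
    (X - 1) * nodal (range n) (fun j => q * q ^ (2 * j + 1)) =
      nodal (range (n + 1)) (fun j => q ^ (2 * j)) := by
  simp only [nodal, prod_range_succ', ← pow_succ', mul_zero, pow_zero, C_1, mul_add, mul_one,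
    add_assoc, one_add_one_eq_two]
  exact mul_comm _ _

/-- The polynomials `∏_{j<n} (X - q ^ j)`; as functions of `q ^ dim`, they count the linearly
independent `n`-tuples in a space over a field with `q` elements. -/
noncomputable def qFallingFactorial (q : k) : Polynomial.Sequence k where
  elems' n := nodal (range n) (q ^ ·)
  degree_eq' n := by simp [Lagrange.degree_nodal]

lemma qFallingFactorial_apply (q : k) (n : ℕ) :
    qFallingFactorial q n = nodal (range n) (q ^ ·) := rfl

lemma isUnit_leadingCoeff_qFallingFactorial (q : k) (n : ℕ) :
    IsUnit (qFallingFactorial q n).leadingCoeff := by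
  rw [qFallingFactorial_apply, (Lagrange.nodal_monic).leadingCoeff]
  exact isUnit_one

/-- The linear functional that sends `∏_{j<n} (X - q ^ j)` to
`x⁻ⁿ q ^ (n (n + 1) / 2) ∏_{j<n} (x - q ^ j)`. Up to a scalar, with `q` the size of the base field
and `x` the size of the extension, these are the moments of the distribution of `q ^ dim ker` over
the quadratic forms of a Gold type code. -/
noncomputable def qTransform (q x : k) : k[X] →ₗ[k] k :=
  ((qFallingFactorial q).basis (isUnit_leadingCoeff_qFallingFactorial q)).constr k fun n =>
    x⁻¹ ^ n * q ^ (n + 1).choose 2 * (nodal (range n) (q ^ ·)).eval x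

lemma qTransform_nodal_pow (q x : k) (n : ℕ) :
    qTransform q x (nodal (range n) (q ^ ·)) =
      x⁻¹ ^ n * q ^ (n + 1).choose 2 * (nodal (range n) (q ^ ·)).eval x := by
  rw [← qFallingFactorial_apply, qTransform,
    ← (qFallingFactorial q).basis_eq_self (isUnit_leadingCoeff_qFallingFactorial q) n,
    Basis.constr_basis, Sequence.basis_eq_self, qFallingFactorial_apply]

lemma qTransform_one (q x : k) : qTransform q x 1 = 1 := by
  simpa using qTransform_nodal_pow q x 0

lemma qTransform_sub_one_mul_comp {q : k} (hq : q ≠ 0) (x : k) (f : k[X]) :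
    qTransform q x ((X - 1) * f.comp (C q⁻¹ * X)) =
      q * x⁻¹ * (x - 1) * qTransform q (x / q) f := by
  have on_basis (n : ℕ) :
      qTransform q x ((X - 1) * (nodal (range n) (q ^ ·)).comp (C q⁻¹ * X)) =
        q * x⁻¹ * (x - 1) * qTransform q (x / q) (nodal (range n) (q ^ ·)) := by
    have eval_div : (x - 1) * (nodal (range n) (q ^ ·)).eval (x / q) =
        q⁻¹ ^ n * (nodal (range (n + 1)) (q ^ ·)).eval x := by
      rw [← sub_one_mul_nodal_pow, div_eq_inv_mul]
      have := congrArg (eval x) (nodal_comp_inv_mul hq (q ^ ·) n)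
      simp only [eval_comp, eval_mul, eval_C, eval_X] at this
      simp only [this, eval_mul, eval_sub, eval_X, eval_one]
      ring
    calc qTransform q x ((X - 1) * (nodal (range n) (q ^ ·)).comp (C q⁻¹ * X))
        = q⁻¹ ^ n * qTransform q x (nodal (range (n + 1)) (q ^ ·)) := by
          rw [nodal_comp_inv_mul hq, mul_left_comm, sub_one_mul_nodal_pow, ← smul_eq_C_mul,
            map_smul, smul_eq_mul]
      _ = q * x⁻¹ * (x / q)⁻¹ ^ n * q ^ (n + 1).choose 2 *
            (q⁻¹ ^ n * (nodal (range (n + 1)) (q ^ ·)).eval x) := by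
          rw [qTransform_nodal_pow, Nat.choose_succ_succ' (n + 1) 1, Nat.choose_one_right,
            inv_div, div_eq_mul_inv, mul_pow]
          ring
      _ = q * x⁻¹ * (x - 1) * qTransform q (x / q) (nodal (range n) (q ^ ·)) := by
          rw [← eval_div, qTransform_nodal_pow]
          ring
  let lhs : k[X] →ₗ[k] k :=
    qTransform q x ∘ₗ LinearMap.mulLeft k (X - 1) ∘ₗ (aeval (C q⁻¹ * X)).toLinearMap
  suffices lhs = (q * x⁻¹ * (x - 1)) • qTransform q (x / q) from DFunLike.congr_fun this f
  refine ((qFallingFactorial q).basis (isUnit_leadingCoeff_qFallingFactorial q)).ext fun n => ?_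
  rw [Sequence.basis_eq_self]
  exact on_basis n

lemma pow_smul_sub_one_mul_nodal_even_comp {q : k} (hq : q ≠ 0) (n : ℕ) :
    q ^ n • ((X - 1) * (nodal (range n) fun j => q ^ (2 * j)).comp (C q⁻¹ * X)) =
      (X - 1) * nodal (range n) fun j => q ^ (2 * j + 1) := by
  rw [nodal_comp_inv_mul hq, smul_eq_C_mul, mul_left_comm (X - 1), ← mul_assoc, ← C_mul,
    ← mul_pow, mul_inv_cancel₀ hq, one_pow, C_1, one_mul]
  simp only [pow_succ']

lemma pow_smul_sub_one_mul_nodal_odd_comp {q : k} (hq : q ≠ 0) (n : ℕ) :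
    q ^ n • ((X - 1) * (nodal (range n) fun j => q ^ (2 * j + 1)).comp (C q⁻¹ * X)) =
      nodal (range (n + 1)) fun j => q ^ (2 * j) := by
  rw [nodal_comp_inv_mul hq, smul_eq_C_mul, mul_left_comm (X - 1), ← mul_assoc, ← C_mul,
    ← mul_pow, mul_inv_cancel₀ hq, one_pow, C_1, one_mul, sub_one_mul_nodal_pow_odd]

/-- The two families are interleaved by `f ↦ (X - 1) f(X / q)`, so the values of the transform
on them are obtained by a simultaneous induction. -/
lemma qTransform_nodal_odd_and_even {q : k} (hq : q ≠ 0) (n : ℕ) :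
    (∀ x ≠ 0, qTransform q x (nodal (range n) fun j => q ^ (2 * j + 1)) =
      x⁻¹ ^ n * (nodal (range n) fun j => q ^ (2 * j + 1)).eval x) ∧
    ∀ x ≠ 0, qTransform q x (nodal (range n) fun j => q ^ (2 * j)) =
      q ^ n * x⁻¹ ^ n * (nodal (range n) fun j => q ^ (2 * j)).eval x := by
  induction n with
  | zero => simp [qTransform_one]
  | succ n ih =>
    obtain ⟨odd_ih, even_ih⟩ := ih
    have even_comp := pow_smul_sub_one_mul_nodal_even_comp hq n
    have odd_comp := pow_smul_sub_one_mul_nodal_odd_comp hq n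
    have eval_comp (p : k[X]) (x : k) : eval x (q ^ n • ((X - 1) * p.comp (C q⁻¹ * X))) =
        q ^ n * ((x - 1) * eval (x / q) p) := by
      simp [div_eq_inv_mul]
    refine ⟨fun x hx => ?_, fun x hx => ?_⟩
    · have odd_succ : (nodal (range (n + 1)) fun j => q ^ (2 * j + 1)) =
          q ^ n • ((X - 1) * (nodal (range n) fun j => q ^ (2 * j)).comp (C q⁻¹ * X)) -
            (q ^ (2 * n + 1) - 1) • nodal (range n) fun j => q ^ (2 * j + 1) := by
        rw [even_comp, smul_eq_C_mul, nodal, prod_range_succ, ← nodal, C_sub, C_1]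
        ring
      have eval_even := congrArg (eval x) even_comp
      rw [eval_comp] at eval_even
      rw [odd_succ, map_sub, map_smul, map_smul, qTransform_sub_one_mul_comp hq,
        even_ih _ (div_ne_zero hx hq), odd_ih x hx, eval_sub, eval_comp, eval_even,
        inv_div, div_pow]
      simp only [eval_smul, smul_eq_mul, eval_mul, eval_sub, eval_X, eval_one] at eval_even ⊢
      have inv_pow_eq : x⁻¹ ^ n = x * x⁻¹ ^ (n + 1) := by
        rw [pow_succ', mul_inv_cancel_left₀ hx]
      linear_combination x⁻¹ ^ (n + 1) * q ^ (2 * n + 1) * eval_even - (q ^ (2 * n + 1) - 1) *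
        (nodal (range n) fun j => q ^ (2 * j + 1)).eval x * inv_pow_eq
    · rw [← odd_comp, map_smul, qTransform_sub_one_mul_comp hq, odd_ih _ (div_ne_zero hx hq),
        eval_comp, smul_eq_mul, inv_div, div_pow]
      ring

lemma qTransform_nodal_odd {q x : k} (hq : q ≠ 0) (hx : x ≠ 0) (n : ℕ) :
    qTransform q x (nodal (range n) fun j => q ^ (2 * j + 1)) =
      x⁻¹ ^ n * (nodal (range n) fun j => q ^ (2 * j + 1)).eval x :=
  (qTransform_nodal_odd_and_even hq n).1 x hx

lemma eq_smul_qTransform_of_nodal_pow {q x c : k} {N : ℕ} {L : k[X] →ₗ[k] k}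
    (h : ∀ n < N, L (nodal (range n) (q ^ ·)) = c * qTransform q x (nodal (range n) (q ^ ·)))
    {f : k[X]} (hf : f.degree < N) : L f = c * qTransform q x f := by
  have on_span : Set.EqOn L (c • qTransform q x)
      (Submodule.span k (qFallingFactorial q '' Set.Iio N)) := by
    refine LinearMap.eqOn_span' (f := L) (g := c • qTransform q x) ?_
    rintro _ ⟨n, hn, rfl⟩
    exact h n hn
  rw [(qFallingFactorial q).span_degreeLT
    fun n _ => isUnit_leadingCoeff_qFallingFactorial q n] at on_span
  exact on_span (mem_degreeLT.2 hf)

lemma sum_prod_sub_pow_odd_of_sum_prod_sub_pow {ι : Type*} (s : Finset ι) (R : ι → k)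
    {q x c : k} (hq : q ≠ 0) (hx : x ≠ 0) {N : ℕ}
    (h : ∀ n < N, ∑ b ∈ s, ∏ j ∈ range n, (R b - q ^ j) =
      c * (x⁻¹ ^ n * q ^ (n + 1).choose 2 * ∏ j ∈ range n, (x - q ^ j)))
    {n : ℕ} (hn : n < N) :
    ∑ b ∈ s, ∏ j ∈ range n, (R b - q ^ (2 * j + 1)) =
      c * (x⁻¹ ^ n * ∏ j ∈ range n, (x - q ^ (2 * j + 1))) := by
  let L : k[X] →ₗ[k] k := ∑ b ∈ s, leval (R b)
  have L_nodal (a : ℕ → k) (r : ℕ) :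
      L (nodal (range r) a) = ∑ b ∈ s, ∏ j ∈ range r, (R b - a j) := by
    simp [L, Lagrange.eval_nodal]
  rw [← L_nodal, eq_smul_qTransform_of_nodal_pow (c := c) (q := q) (x := x) (N := N),
    qTransform_nodal_odd hq hx, Lagrange.eval_nodal]
  · intro r hr
    rw [L_nodal, h r hr, qTransform_nodal_pow, Lagrange.eval_nodal]
  · rw [Lagrange.degree_nodal, card_range]
    exact_mod_cast hn

lemma inv_eq_sum_prod_sub_pow_odd {q R : k} (hq : q ≠ 0) (hR : R ≠ 0) (N : ℕ) :
    R⁻¹ = ∑ u ∈ range N, (-1) ^ u * (q ^ ((u + 1) ^ 2))⁻¹ * ∏ j ∈ range u, (R - q ^ (2 * j + 1)) +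
      (-1) ^ N * (q ^ (N ^ 2))⁻¹ * (∏ j ∈ range N, (R - q ^ (2 * j + 1))) * R⁻¹ := by
  induction N with
  | zero => simp
  | succ N ih =>
    have remainder_split (Z : k) : (-1) ^ N * (q ^ N ^ 2)⁻¹ * Z * R⁻¹ =
        (-1) ^ N * (q ^ (N + 1) ^ 2)⁻¹ * Z +
          (-1) ^ (N + 1) * (q ^ (N + 1) ^ 2)⁻¹ * (Z * (R - q ^ (2 * N + 1))) * R⁻¹ := by
      rw [show (N + 1) ^ 2 = N ^ 2 + (2 * N + 1) by ring, pow_add q (N ^ 2), pow_succ (-1 : k) N]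
      field_simp
      ring
    rw [sum_range_succ, prod_range_succ, add_assoc, ← remainder_split]
    exact ih

end QTransform

section AlternatingForm

variable {K V : Type*} [Field K] [AddCommGroup V] [Module K V] {B : LinearMap.BilinForm K V}

lemma sup_span_singleton_le_orthogonal (hB : B.IsAlt) {W : Submodule K V}
    (hW : W ≤ B.orthogonal W) {x : V} (hx : x ∈ B.orthogonal W) :
    W ⊔ Submodule.span K {x} ≤ B.orthogonal (W ⊔ Submodule.span K {x}) := by
  intro y hy z hz
  obtain ⟨w, hw, _, hv, rfl⟩ := Submodule.mem_sup.1 hy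
  obtain ⟨w', hw', _, hv', rfl⟩ := Submodule.mem_sup.1 hz
  obtain ⟨a, rfl⟩ := Submodule.mem_span_singleton.1 hv
  obtain ⟨a', rfl⟩ := Submodule.mem_span_singleton.1 hv'
  have w'_w : B w' w = 0 := hW hw w' hw'
  have w'_x : B w' x = 0 := hx w' hw'
  have x_w : B x w = 0 := hB.isRefl w x (hx w hw)
  simp [w'_w, w'_x, x_w, hB x]

lemma exists_orthogonal_eq_self [FiniteDimensional K V] (hB : B.IsAlt) :
    ∃ W : Submodule K V, B.orthogonal W = W := by
  obtain ⟨W, hW, hmax⟩ := (wellFounded_gt (α := Submodule K V)).has_min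
    {W | W ≤ B.orthogonal W} ⟨⊥, by simp⟩
  refine ⟨W, le_antisymm (fun x hx => ?_) hW⟩
  by_contra hxW
  refine hmax _ (sup_span_singleton_le_orthogonal hB hW hx) (le_sup_left.lt_of_ne fun h => hxW ?_)
  rw [h]
  exact Submodule.mem_sup_right (Submodule.mem_span_singleton_self x)

lemma even_finrank_add_finrank_orthogonal_top [FiniteDimensional K V] (hB : B.IsAlt) :
    Even (finrank K V + finrank K (B.orthogonal ⊤)) := by
  obtain ⟨W, hW⟩ := exists_orthogonal_eq_self hB
  have radical_le : B.orthogonal ⊤ ≤ W :=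
    (LinearMap.BilinForm.orthogonal_le le_top).trans_eq hW
  have h := LinearMap.BilinForm.finrank_add_finrank_orthogonal hB.isRefl W
  rw [hW, inf_eq_right.2 radical_le] at h
  exact ⟨_, h.symm⟩

end AlternatingForm

section GaloisSum

variable {K F : Type*} [Field K] [Field F] [Algebra K F]

/-- The linear operator `z ↦ ∑_{l<n} c l * ρ^l z`, a polynomial in the automorphism `ρ` with
coefficients on the left. -/
noncomputable def autPolynomial (ρ : Gal(F/K)) (c : ℕ → F) (n : ℕ) : F →ₗ[K] F :=
  ∑ l ∈ range n, LinearMap.mulLeft K (c l) ∘ₗ (ρ ^ l).toLinearMap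

lemma autPolynomial_apply (ρ : Gal(F/K)) (c : ℕ → F) (n : ℕ) (z : F) :
    autPolynomial ρ c n z = ∑ l ∈ range n, c l * (ρ ^ l) z := by
  simp [autPolynomial]

/-- Summation by parts: a root `z₀` splits the factor `z ↦ ρ (z / z₀) - z / z₀` off on the right,
and the cofactor has the values of the truncations at `z₀` as its coefficients. -/
lemma autPolynomial_succ_mul_of_apply_eq_zero {ρ : Gal(F/K)} {c : ℕ → F} {n : ℕ} {z₀ : F}
    (hz₀ : autPolynomial ρ c (n + 1) z₀ = 0) (w : F) :
    autPolynomial ρ c (n + 1) (z₀ * w) =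
      -autPolynomial ρ (fun l => autPolynomial ρ c (l + 1) z₀) n (ρ w - w) := by
  have pow_succ_sub (l : ℕ) : (ρ ^ (l + 1)) w - (ρ ^ l) w = (ρ ^ l) (ρ w - w) := by
    rw [map_sub, pow_succ, AlgEquiv.mul_apply]
  calc autPolynomial ρ c (n + 1) (z₀ * w)
      = ∑ l ∈ range (n + 1), (ρ ^ l) w • (c l * (ρ ^ l) z₀) := by
        rw [autPolynomial_apply]
        exact sum_congr rfl fun l _ => by rw [map_mul, smul_eq_mul]; ring
    _ = -∑ l ∈ range n, autPolynomial ρ c (l + 1) z₀ * (ρ ^ l) (ρ w - w) := by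
        rw [sum_range_by_parts, ← autPolynomial_apply, hz₀, smul_zero, zero_sub,
          Nat.add_sub_cancel]
        simp only [pow_succ_sub, autPolynomial_apply, smul_eq_mul, mul_comm]
    _ = _ := by rw [autPolynomial_apply (n := n)]

lemma exists_autPolynomial_succ_apply_ne_zero {ρ : Gal(F/K)} {c : ℕ → F} {n : ℕ} {z₀ : F}
    (hz₀ : z₀ ≠ 0) (hn : autPolynomial ρ c (n + 1) z₀ = 0) (hc : ∃ l < n + 1, c l ≠ 0) :
    ∃ l < n, autPolynomial ρ c (l + 1) z₀ ≠ 0 := by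
  by_contra! h
  obtain ⟨l, hl, hcl⟩ := hc
  have truncation_eq_zero : ∀ j ≤ n + 1, autPolynomial ρ c j z₀ = 0 := by
    rintro (_ | j) hj
    · simp [autPolynomial]
    · rcases (Nat.le_of_succ_le_succ hj).eq_or_lt with rfl | hj
      exacts [hn, h j hj]
  have term_eq_zero : c l * (ρ ^ l) z₀ = 0 := by
    have := truncation_eq_zero (l + 1) hl
    rwa [autPolynomial_apply, sum_range_succ, ← autPolynomial_apply,
      truncation_eq_zero l (Nat.le_of_lt hl), zero_add] at this
  exact hcl ((mul_eq_zero.1 term_eq_zero).resolve_right ((map_ne_zero _).2 hz₀))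

lemma finrank_le_finrank_ker_add {V W : Type*} [AddCommGroup V] [Module K V]
    [FiniteDimensional K V] [AddCommGroup W] [Module K W] (f : V →ₗ[K] W) {A : Submodule K V}
    {A' : Submodule K W} [FiniteDimensional K A'] (h : A ≤ A'.comap f) :
    finrank K A ≤ finrank K (LinearMap.ker f) + finrank K A' := by
  have ker_le : finrank K (LinearMap.ker (f.restrict h)) ≤ finrank K (LinearMap.ker f) := by
    refine LinearMap.finrank_le_finrank_of_injective (f := (A.subtype ∘ₗ
      (LinearMap.ker (f.restrict h)).subtype).codRestrict _ fun x => ?_) ?_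
    · exact congrArg Subtype.val (LinearMap.mem_ker.1 x.2)
    · exact fun x y hxy => Subtype.ext (Subtype.ext (congrArg Subtype.val hxy :))
  rw [← (f.restrict h).finrank_range_add_finrank_ker, add_comm]
  exact Nat.add_le_add ker_le (Submodule.finrank_le _)

lemma finrank_ker_aut_div_sub_le {ρ : Gal(F/K)}
    (hρ : ∀ x, ρ x = x → x ∈ Set.range (algebraMap K F)) {z₀ : F} (hz₀ : z₀ ≠ 0) :
    finrank K (LinearMap.ker
      ((ρ.toLinearMap - LinearMap.id) ∘ₗ LinearMap.mulRight K z₀⁻¹)) ≤ 1 := by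
  refine (Submodule.finrank_mono (t := Submodule.span K {z₀}) fun z hz => ?_).trans
    (finrank_span_singleton hz₀).le
  obtain ⟨a, ha⟩ := hρ (z * z₀⁻¹) (sub_eq_zero.1 hz)
  exact Submodule.mem_span_singleton.2 ⟨a, by
    rw [Algebra.smul_def, ha, inv_mul_cancel_right₀ hz₀]⟩

variable [FiniteDimensional K F]

lemma finrank_ker_autPolynomial_le {ρ : Gal(F/K)}
    (hρ : ∀ x, ρ x = x → x ∈ Set.range (algebraMap K F)) (n : ℕ) (c : ℕ → F)
    (hc : ∃ l < n + 1, c l ≠ 0) :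
    finrank K (LinearMap.ker (autPolynomial ρ c (n + 1))) ≤ n := by
  induction n generalizing c with
  | zero =>
    obtain ⟨l, hl, hcl⟩ := hc
    obtain rfl : l = 0 := by lia
    have : LinearMap.ker (autPolynomial ρ c 1) = ⊥ :=
      LinearMap.ker_eq_bot'.2 fun z hz => by simpa [autPolynomial, hcl] using hz
    simp [this]
  | succ n ih =>
    by_cases hker : LinearMap.ker (autPolynomial ρ c (n + 1 + 1)) = ⊥
    · rw [hker, finrank_bot]
      exact Nat.zero_le _
    obtain ⟨z₀, hz₀_mem, hz₀⟩ := Submodule.exists_mem_ne_zero_of_ne_bot hker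
    let T : F →ₗ[K] F := (ρ.toLinearMap - LinearMap.id) ∘ₗ LinearMap.mulRight K z₀⁻¹
    have maps_to : LinearMap.ker (autPolynomial ρ c (n + 1 + 1)) ≤ (LinearMap.ker
        (autPolynomial ρ (fun l => autPolynomial ρ c (l + 1) z₀) (n + 1))).comap T := by
      intro z hz
      have := autPolynomial_succ_mul_of_apply_eq_zero hz₀_mem (z * z₀⁻¹)
      rw [mul_comm z, mul_inv_cancel_left₀ hz₀, LinearMap.mem_ker.1 hz, zero_eq_neg,
        mul_comm _ z] at this
      exact this
    calc _ ≤ _ := finrank_le_finrank_ker_add T maps_to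
      _ ≤ 1 + n := Nat.add_le_add (finrank_ker_aut_div_sub_le hρ hz₀)
        (ih _ (exists_autPolynomial_succ_apply_ne_zero hz₀ hz₀_mem hc))
      _ = n + 1 := add_comm _ _

/-- The linear operator `z ↦ ∑ g, c g * g z`. This is how the element `∑ g, c g * g` of the
twisted group algebra of `Gal(F/K)` acts on `F`. -/
noncomputable def galoisSum (c : Gal(F/K) → F) : F →ₗ[K] F :=
  ∑ g, LinearMap.mulLeft K (c g) ∘ₗ g.toLinearMap

lemma galoisSum_apply (c : Gal(F/K) → F) (z : F) : galoisSum c z = ∑ g, c g * g z := by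
  simp [galoisSum]

/-- The interval of the `N + 1` consecutive powers `ρ ^ w, …, ρ ^ (w + N)` of a group element. -/
def zpowInterval {G : Type*} [Group G] (ρ : G) (w : ℤ) (N : ℕ) : Set G :=
  {g | ∃ l ≤ N, g = ρ ^ (w + (l : ℤ))}

lemma galoisSum_eq_autPolynomial_comp {ρ : Gal(F/K)} {c : Gal(F/K) → F} {w : ℤ} {N : ℕ}
    (hN : N < orderOf ρ) (hw : c.support ⊆ zpowInterval ρ w N) :
    galoisSum c =
      autPolynomial ρ (fun l => c (ρ ^ (w + (l : ℤ)))) (N + 1) ∘ₗ (ρ ^ w).toLinearMap := by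
  ext z
  rw [galoisSum_apply, LinearMap.comp_apply, autPolynomial_apply]
  have zpow_add_apply (l : ℕ) : (ρ ^ (w + (l : ℤ))) z = (ρ ^ l) ((ρ ^ w) z) := by
    rw [add_comm, zpow_add, zpow_natCast, AlgEquiv.mul_apply]
  symm
  refine sum_of_injOn (fun l : ℕ => ρ ^ (w + (l : ℤ))) (fun a ha b hb hab => ?_) (by simp)
    (fun g _ hg => ?_) (fun l _ => by rw [zpow_add_apply]; rfl)
  · simp only [zpow_add, zpow_natCast, mul_right_inj] at hab
    simp only [coe_range, Set.mem_Iio] at ha hb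
    exact pow_injOn_Iio_orderOf (Set.mem_Iio.2 (by lia)) (Set.mem_Iio.2 (by lia)) hab
  · by_contra h
    obtain ⟨l, hl, rfl⟩ := hw (left_ne_zero_of_mul h)
    exact hg ⟨l, by simpa using Nat.lt_succ_of_le hl, rfl⟩

lemma finrank_ker_galoisSum_le [IsGalois K F] {ρ : Gal(F/K)}
    (hρ : ∀ g, g ∈ Subgroup.zpowers ρ) {c : Gal(F/K) → F} (hc : c ≠ 0) {w : ℤ} {N : ℕ}
    (hN : N < orderOf ρ) (hw : c.support ⊆ zpowInterval ρ w N) :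
    finrank K (LinearMap.ker (galoisSum c)) ≤ N := by
  have fixed_mem_range (x : F) (hx : ρ x = x) : x ∈ Set.range (algebraMap K F) := by
    rw [IsGalois.mem_range_algebraMap_iff_fixed]
    have zpowers_le : Subgroup.zpowers ρ ≤ MulAction.stabilizer Gal(F/K) x :=
      Subgroup.zpowers_le.2 hx
    exact fun g => zpowers_le (hρ g)
  obtain ⟨g, hg⟩ := Function.ne_iff.1 hc
  obtain ⟨l, hl, rfl⟩ := hw hg
  rw [galoisSum_eq_autPolynomial_comp hN hw, LinearMap.ker_comp]
  refine (LinearEquiv.finrank_eq ((ρ ^ w).toLinearEquiv.submoduleMap _)).trans_le ?_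
  refine (Submodule.finrank_mono (Submodule.map_comap_le _ _)).trans ?_
  exact finrank_ker_autPolynomial_le fixed_mem_range N _ ⟨l, Nat.lt_succ_of_le hl, hg⟩

end GaloisSum

section GoldFamily

variable {K F ι : Type*} [Field K] [Field F] [Algebra K F]

lemma apply_aut_inv_apply (g : Gal(F/K)) (x : F) : g (g⁻¹ x) = x :=
  g.apply_symm_apply x

variable [Fintype ι]

open Classical in
/-- The coefficients, indexed by the Galois group, of the operator
`x ↦ ∑ j, (b j * J j x + (J j)⁻¹ (b j * x))`. -/
noncomputable def polarCoeff (J : ι → Gal(F/K)) (b : ι → F) (g : Gal(F/K)) : F :=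
  ∑ j, ((if g = J j then b j else 0) + (if g = (J j)⁻¹ then (J j)⁻¹ (b j) else 0))

variable [FiniteDimensional K F]

/-- The operator `L` for which `Tr (L x * y)` is the polar form of the quadratic form
`x ↦ ∑ j, Tr (b j * x * J j x)`. -/
noncomputable def polarOp (J : ι → Gal(F/K)) (b : ι → F) : F →ₗ[K] F :=
  galoisSum (polarCoeff J b)

lemma polarOp_apply (J : ι → Gal(F/K)) (b : ι → F) (x : F) :
    polarOp J b x = ∑ j, (b j * J j x + (J j)⁻¹ (b j * x)) := by
  classical
  simp only [polarOp, galoisSum_apply, polarCoeff, sum_mul]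
  rw [sum_comm]
  refine sum_congr rfl fun j _ => ?_
  simp [add_mul, sum_add_distrib, ite_mul]

lemma trace_polarOp_mul (J : ι → Gal(F/K)) (b : ι → F) (x y : F) :
    Algebra.trace K F (polarOp J b x * y) =
      Algebra.trace K F (∑ j, b j * (J j x * y + x * J j y)) := by
  rw [polarOp_apply, sum_mul, map_sum, map_sum]
  refine sum_congr rfl fun j _ => ?_
  have move_inv : Algebra.trace K F ((J j)⁻¹ (b j * x) * y) =
      Algebra.trace K F (b j * x * J j y) := by
    rw [← Algebra.trace_eq_of_algEquiv (J j), map_mul, apply_aut_inv_apply]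
  rw [add_mul, map_add, move_inv, ← map_add]
  congr 1
  ring

lemma even_finrank_add_finrank_ker_polarOp [CharP F 2] [Algebra.IsSeparable K F]
    (J : ι → Gal(F/K)) (b : ι → F) :
    Even (finrank K F + finrank K (LinearMap.ker (polarOp J b))) := by
  let B : LinearMap.BilinForm K F := (Algebra.traceForm K F).comp (polarOp J b) LinearMap.id
  have B_isAlt : B.IsAlt := fun x => by
    refine (trace_polarOp_mul J b x x).trans ?_
    simp only [mul_comm x, CharTwo.add_self_eq_zero, mul_zero, sum_const_zero, map_zero]
  have radical_eq : B.orthogonal ⊤ = LinearMap.ker (polarOp J b) := by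
    ext x
    rw [LinearMap.BilinForm.mem_orthogonal_iff, LinearMap.mem_ker]
    refine ⟨fun h => (traceForm_nondegenerate K F).1 _ fun y => B_isAlt.isRefl y x (h y trivial),
      fun h y _ => B_isAlt.isRefl x y ?_⟩
    change Algebra.trace K F (polarOp J b x * y) = 0
    rw [h, zero_mul, map_zero]
  rw [← radical_eq]
  exact even_finrank_add_finrank_orthogonal_top B_isAlt

/-- Families of Galois automorphisms whose polar operators form an optimal set of alternating
forms: the `J i` and their inverses, as well as the remaining nontrivial automorphisms, are
confined to short intervals of powers of a generator `ρ`. The family is indexed by the `k - 1`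
decimations, so that `2 * Fintype.card ι` is the `2 * (k - 1)` of the paper. -/
structure IsGoldFamily (ρ : Gal(F/K)) (J : ι → Gal(F/K)) : Prop where
  gen : ∀ g, g ∈ Subgroup.zpowers ρ
  two_mul_card_lt : 2 * Fintype.card ι < finrank K F
  odd_finrank : Odd (finrank K F)
  inj : Function.Injective J
  ne_inv : ∀ i j, J i ≠ (J j)⁻¹
  window : ∃ w, ∀ i, J i ∈ zpowInterval ρ w (2 * Fintype.card ι) ∧
    (J i)⁻¹ ∈ zpowInterval ρ w (2 * Fintype.card ι)
  cowindow : ∃ w, ∀ g ≠ 1, g ∉ Set.range J → g⁻¹ ∉ Set.range J →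
    g ∈ zpowInterval ρ w (finrank K F - 1 - 2 * Fintype.card ι)

variable {ρ : Gal(F/K)} {J : ι → Gal(F/K)}

omit [FiniteDimensional K F] in
lemma polarCoeff_apply_self (hJ : IsGoldFamily ρ J) (b : ι → F) (i : ι) :
    polarCoeff J b (J i) = b i := by
  classical
  simp [polarCoeff, hJ.inj.eq_iff, hJ.ne_inv]

variable [IsGalois K F]

lemma orderOf_eq_finrank_of_forall_mem_zpowers (h : ∀ g, g ∈ Subgroup.zpowers ρ) :
    orderOf ρ = finrank K F := by
  rw [orderOf_eq_card_of_forall_mem_zpowers h, IsGalois.card_aut_eq_finrank]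

lemma finrank_ker_polarOp_le (hJ : IsGoldFamily ρ J) {b : ι → F} (hb : b ≠ 0) :
    finrank K (LinearMap.ker (polarOp J b)) ≤ 2 * Fintype.card ι := by
  obtain ⟨w, hw⟩ := hJ.window
  obtain ⟨i, hi⟩ := Function.ne_iff.1 hb
  have coeff_ne_zero : polarCoeff J b ≠ 0 := fun h =>
    hi (by rw [← polarCoeff_apply_self hJ b i, h, Pi.zero_apply, Pi.zero_apply])
  have card_lt_orderOf : 2 * Fintype.card ι < orderOf ρ :=
    hJ.two_mul_card_lt.trans_eq (orderOf_eq_finrank_of_forall_mem_zpowers hJ.gen).symm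
  refine finrank_ker_galoisSum_le hJ.gen coeff_ne_zero card_lt_orderOf (w := w) fun g hg => ?_
  by_contra hno
  refine hg (sum_eq_zero fun j _ => ?_)
  rw [if_neg, if_neg, add_zero]
  · rintro rfl; exact hno (hw j).2
  · rintro rfl; exact hno (hw j).1

lemma exists_finrank_ker_polarOp [CharP F 2] (hJ : IsGoldFamily ρ J) {b : ι → F} (hb : b ≠ 0) :
    ∃ s < Fintype.card ι, finrank K (LinearMap.ker (polarOp J b)) = 2 * s + 1 := by
  obtain ⟨a, ha⟩ := even_finrank_add_finrank_ker_polarOp J b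
  obtain ⟨c, hc⟩ := hJ.odd_finrank
  have := finrank_ker_polarOp_le hJ hb
  exact ⟨a - c - 1, by lia, by lia⟩

variable {κ : Type*} [Fintype κ]

/-- The coefficients of the linear operator `z ↦ ∑ i, (Tr (x i * z) * y i + Tr (y i * z) * x i)`,
which are at the same time the coefficients of `b` in the sum over `i` of the polar forms at
`(x i, y i)`. -/
def pairingCoeff (x y : κ → F) (g : Gal(F/K)) : F :=
  ∑ i, (g (x i) * y i + x i * g (y i))

/-- The pairs `(x i, y i)` are jointly orthogonal for all polar forms, that is,
`∑ i, Tr (polarOp J b (x i) * y i) = 0` for all `b`. -/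
def IsPolarOrthogonal (J : ι → Gal(F/K)) (x y : κ → F) : Prop :=
  ∀ j, pairingCoeff x y (J j) = 0

omit [FiniteDimensional K F] [Fintype ι] [IsGalois K F] in
lemma isPolarOrthogonal_sum_smul [CharP F 2] (J : ι → Gal(F/K)) (x : κ → F)
    (S : Sym2 κ → K) : IsPolarOrthogonal J x (fun i => ∑ l, S s(i, l) • x l) := by
  intro j
  simp only [pairingCoeff, map_sum, map_smul, mul_sum, sum_add_distrib]
  rw [sum_comm (f := fun i l => x i * S s(i, l) • J j (x l)), ← sum_add_distrib]
  refine sum_eq_zero fun i _ => ?_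
  rw [← sum_add_distrib]
  refine sum_eq_zero fun l _ => ?_
  rw [Sym2.eq_swap, mul_smul_comm, mul_smul_comm, mul_comm, CharTwo.add_self_eq_zero]

lemma galoisSum_pairingCoeff_apply (x y : κ → F) (z : F) :
    galoisSum (K := K) (pairingCoeff x y) z =
      ∑ i, (Algebra.trace K F (x i * z) • y i + Algebra.trace K F (y i * z) • x i) := by
  simp only [galoisSum_apply, pairingCoeff, Algebra.smul_def, trace_eq_sum_automorphisms, sum_mul]
  rw [sum_comm]
  refine sum_congr rfl fun i _ => ?_
  rw [← sum_add_distrib]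
  refine sum_congr rfl fun g _ => ?_
  simp only [map_mul]
  ring

lemma finrank_le_finrank_ker_galoisSum_pairingCoeff (x y : κ → F) :
    finrank K F ≤ 2 * Fintype.card κ +
      finrank K (LinearMap.ker (galoisSum (K := K) (pairingCoeff x y))) := by
  have range_le : LinearMap.range (galoisSum (K := K) (pairingCoeff x y)) ≤
      Submodule.span K (Set.range (Sum.elim x y)) := by
    rintro _ ⟨z, rfl⟩
    rw [galoisSum_pairingCoeff_apply]
    exact Submodule.sum_mem _ fun i _ => add_mem
      (Submodule.smul_mem _ _ (Submodule.subset_span ⟨.inr i, rfl⟩))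
      (Submodule.smul_mem _ _ (Submodule.subset_span ⟨.inl i, rfl⟩))
  rw [← (galoisSum (K := K) (pairingCoeff x y)).finrank_range_add_finrank_ker, two_mul,
    ← Fintype.card_sum]
  exact Nat.add_le_add_right
    ((Submodule.finrank_mono range_le).trans (finrank_range_le_card (Sum.elim x y))) _

/-- The coefficients at `1` and at the `(J i)^{±1}` vanish, so the remaining ones are confined to
the second interval; but the operator has too small a rank for that unless it is zero. -/
lemma pairingCoeff_eq_zero [CharP F 2] (hJ : IsGoldFamily ρ J)
    (hκ : Fintype.card κ ≤ Fintype.card ι) {x y : κ → F} (hy : IsPolarOrthogonal J x y) :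
    pairingCoeff (K := K) x y = 0 := by
  by_contra hne
  obtain ⟨w, hw⟩ := hJ.cowindow
  have apply_pairingCoeff_inv (g : Gal(F/K)) :
      g (pairingCoeff x y g⁻¹) = pairingCoeff x y g := by
    simp only [pairingCoeff, map_sum, map_add, map_mul, apply_aut_inv_apply]
    exact sum_congr rfl fun i _ => by ring
  have support_subset : (pairingCoeff x y).support ⊆
      zpowInterval ρ w (finrank K F - 1 - 2 * Fintype.card ι) := by
    refine fun g hg => hw g ?_ ?_ ?_
    · rintro rfl
      exact hg (sum_eq_zero fun i _ => CharTwo.add_self_eq_zero _)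
    · rintro ⟨i, rfl⟩
      exact hg (hy i)
    · rintro ⟨i, hi⟩
      exact hg (by rw [← apply_pairingCoeff_inv, ← hi, hy i, map_zero])
  have := hJ.two_mul_card_lt
  have ker_le := finrank_ker_galoisSum_le hJ.gen hne
    (by rw [orderOf_eq_finrank_of_forall_mem_zpowers hJ.gen]; lia) support_subset
  have := finrank_le_finrank_ker_galoisSum_pairingCoeff (K := K) x y
  lia

omit [Fintype κ] in
lemma exists_trace_mul_eq_ite [Finite κ] [DecidableEq κ] {x : κ → F} (hx : LinearIndependent K x) :
    ∃ z : κ → F, ∀ i j, Algebra.trace K F (x i * z j) = if i = j then 1 else 0 := by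
  have := Fintype.ofFinite κ
  obtain ⟨φ, hφ⟩ := LinearMap.exists_leftInverse_of_injective _ (LinearMap.ker_eq_bot.2
    (linearIndependent_iff_injective_fintypeLinearCombination.1 hx))
  have φ_apply (i : κ) : φ (x i) = Pi.single i 1 := by
    simpa [Fintype.linearCombination_apply_single] using
      LinearMap.congr_fun hφ (Pi.single i 1)
  have nondegenerate := traceForm_nondegenerate K F
  refine ⟨fun j => ((Algebra.traceForm K F).toDual nondegenerate).symm (LinearMap.proj j ∘ₗ φ),
    fun i j => ?_⟩
  rw [mul_comm, ← Algebra.traceForm_apply, LinearMap.BilinForm.apply_toDual_symm_apply]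
  simp [φ_apply, Pi.single_apply, eq_comm]

lemma exists_eq_sum_smul_of_isPolarOrthogonal [CharP F 2] (hJ : IsGoldFamily ρ J)
    (hκ : Fintype.card κ ≤ Fintype.card ι) {x y : κ → F} (hx : LinearIndependent K x)
    (hy : IsPolarOrthogonal J x y) :
    ∃ S : Sym2 κ → K, y = fun i => ∑ l, S s(i, l) • x l := by
  classical
  obtain ⟨z, hz⟩ := exists_trace_mul_eq_ite hx
  have y_eq (j : κ) : y j = ∑ i, Algebra.trace K F (y i * z j) • x i := by
    have := galoisSum_pairingCoeff_apply (K := K) x y (z j)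
    rw [galoisSum_apply] at this
    simp only [pairingCoeff_eq_zero hJ hκ hy, Pi.zero_apply, zero_mul, sum_const_zero, hz,
      sum_add_distrib, ite_smul, one_smul, zero_smul, sum_ite_eq', mem_univ, if_true] at this
    exact CharTwo.add_eq_zero.1 this.symm
  have coeff_symm (j l : κ) :
      Algebra.trace K F (y j * z l) = Algebra.trace K F (y l * z j) := by
    conv_lhs => rw [y_eq j]
    simp [sum_mul, hz]
  refine ⟨Sym2.lift ⟨fun i j => Algebra.trace K F (y i * z j), coeff_symm⟩, funext fun j => ?_⟩
  simp only [Sym2.lift_mk]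
  exact (y_eq j).trans (sum_congr rfl fun i _ => by rw [coeff_symm])

lemma natCard_isPolarOrthogonal [CharP F 2] (hJ : IsGoldFamily ρ J)
    (hκ : Fintype.card κ ≤ Fintype.card ι) {x : κ → F} (hx : LinearIndependent K x) :
    Nat.card {y : κ → F // IsPolarOrthogonal J x y} =
      Nat.card K ^ (Fintype.card κ + 1).choose 2 := by
  let toTuple (S : Sym2 κ → K) : {y : κ → F // IsPolarOrthogonal J x y} :=
    ⟨fun i => ∑ l, S s(i, l) • x l, isPolarOrthogonal_sum_smul J x S⟩
  have toTuple_bijective : Function.Bijective toTuple := by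
    refine ⟨fun S S' h => funext fun p => ?_, fun ⟨y, hy⟩ => ?_⟩
    · induction p using Sym2.ind with
      | _ i l =>
        exact congrFun (linearIndependent_iff_injective_fintypeLinearCombination.1 hx
          (a₁ := fun l => S s(i, l)) (a₂ := fun l => S' s(i, l))
          (by simpa [Fintype.linearCombination_apply] using
            congrFun (congrArg Subtype.val h) i)) l
    · obtain ⟨S, hS⟩ := exists_eq_sum_smul_of_isPolarOrthogonal hJ hκ hx hy
      exact ⟨S, Subtype.ext hS.symm⟩
  classical
  rw [← Nat.card_eq_of_bijective _ toTuple_bijective, Nat.card_fun,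
    Nat.card_eq_fintype_card (α := Sym2 κ), Sym2.card]

end GoldFamily

section AddChar

lemma addChar_sum {A M κ : Type*} [AddCommMonoid A] [CommMonoid M] (ψ : AddChar A M)
    (s : Finset κ) (f : κ → A) : ψ (∑ i ∈ s, f i) = ∏ i ∈ s, ψ (f i) :=
  map_prod ψ.toMonoidHom (fun i => Multiplicative.ofAdd (f i)) s

lemma sum_pi_addChar_sum_mul {R R' κ : Type*} [CommRing R] [Fintype R] [CommRing R'] [IsDomain R']
    [Fintype κ] [DecidableEq κ] {ψ : AddChar R R'} (hψ : ψ.IsPrimitive) (z : κ → R)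
    [Decidable (z = 0)] :
    ∑ y : κ → R, ψ (∑ i, y i * z i) =
      if z = 0 then (Fintype.card R : R') ^ Fintype.card κ else 0 := by
  classical
  simp_rw [addChar_sum]
  rw [← Fintype.piFinset_univ, ← prod_univ_sum (fun _ => univ) (fun i v => ψ (v * z i))]
  simp_rw [AddChar.sum_mulShift _ hψ]
  split_ifs with hz
  · simp [hz]
  · obtain ⟨i, hi⟩ := Function.ne_iff.1 hz
    exact prod_eq_zero (mem_univ i) (by rw [if_neg (by simpa using hi), Nat.cast_zero])

end AddChar

section LinearIndependentTuples

variable {K V : Type*} [Field K] [Fintype K] [AddCommGroup V] [Module K V]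

lemma natCard_linearIndependent_eq_prod [Finite V] (R : Type*) [CommRing R] (r : ℕ) :
    (Nat.card {s : Fin r → V // LinearIndependent K s} : R) =
      ∏ j ∈ range r, ((Nat.card V : R) - (Fintype.card K : R) ^ j) := by
  rw [Module.natCard_eq_pow_finrank (K := K) (V := V), Nat.card_eq_fintype_card (α := K),
    Nat.cast_pow]
  rcases le_or_gt r (finrank K V) with h | h
  · rw [card_linearIndependent h, Fin.prod_univ_eq_prod_range
      (fun j => Fintype.card K ^ finrank K V - Fintype.card K ^ j), Nat.cast_prod]
    refine prod_congr rfl fun j hj => ?_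
    rw [Nat.cast_sub (Nat.pow_le_pow_right Fintype.card_pos ((mem_range.1 hj).le.trans h)),
      Nat.cast_pow, Nat.cast_pow]
  · rw [prod_eq_zero (mem_range.2 h) (sub_self _)]
    have : IsEmpty {s : Fin r → V // LinearIndependent K s} := by
      refine ⟨fun s => h.not_ge ?_⟩
      simpa using s.2.fintype_card_le_finrank
    rw [Nat.card_of_isEmpty, Nat.cast_zero]

omit [Fintype K] in
open Classical in
lemma natCard_linearIndependent_submodule [Fintype V] (W : Submodule K V) (r : ℕ) :
    Nat.card {s : Fin r → W // LinearIndependent K s} =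
      #{x : Fin r → V | LinearIndependent K x ∧ ∀ i, x i ∈ W} := by
  rw [← Fintype.card_subtype, ← Nat.card_eq_fintype_card]
  exact Nat.card_congr
    { toFun := fun s => ⟨fun i => s.1 i, s.2.map' W.subtype W.ker_subtype, fun i => (s.1 i).2⟩
      invFun := fun x => ⟨fun i => ⟨x.1 i, x.2.2 i⟩, .of_comp W.subtype x.2.1⟩ }

end LinearIndependentTuples

section PolarPairing

variable {K F ι : Type*} [Field K] [Field F] [Finite F] [Algebra K F] [Fintype ι]
  {ρ : Gal(F/K)} {J : ι → Gal(F/K)} {ψ : AddChar F ℤ}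

lemma addChar_mul_polarOp (hψK : ∀ (g : Gal(F/K)) x, ψ (g x) = ψ x) (b : ι → F) (x y : F) :
    ψ (y * polarOp J b x) = ψ (∑ j, b j * (J j x * y + x * J j y)) := by
  have move_inv (g : Gal(F/K)) (v : F) : ψ (y * g⁻¹ v) = ψ (g y * v) := by
    rw [← hψK g, map_mul, apply_aut_inv_apply]
  rw [polarOp_apply, mul_sum, addChar_sum, addChar_sum]
  refine prod_congr rfl fun j _ => ?_
  rw [mul_add, AddChar.map_add_eq_mul, move_inv, mul_add, AddChar.map_add_eq_mul]
  congr 2 <;> ring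

lemma addChar_sum_mul_polarOp (hψK : ∀ (g : Gal(F/K)) x, ψ (g x) = ψ x) {κ : Type*} [Fintype κ]
    (b : ι → F) (x y : κ → F) :
    ψ (∑ i, y i * polarOp J b (x i)) = ψ (∑ j, b j * pairingCoeff x y (J j)) := by
  simp_rw [addChar_sum, addChar_mul_polarOp hψK, ← addChar_sum, pairingCoeff, mul_sum]
  rw [sum_comm]

/-- The remainder of the expansion vanishes, because the kernel of `polarOp J b` has odd dimension
less than `2 * Fintype.card ι`. -/
lemma inv_card_ker_polarOp_eq_sum [Fintype K] [CharP F 2] (hJ : IsGoldFamily ρ J) {b : ι → F}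
    (hb : b ≠ 0) :
    (Nat.card (LinearMap.ker (polarOp J b)) : ℝ)⁻¹ =
      ∑ u ∈ range (Fintype.card ι), (-1) ^ u * ((Fintype.card K : ℝ) ^ ((u + 1) ^ 2))⁻¹ *
        ∏ j ∈ range u,
          ((Nat.card (LinearMap.ker (polarOp J b)) : ℝ) - (Fintype.card K : ℝ) ^ (2 * j + 1)) := by
  obtain ⟨s, hs, hfinrank⟩ := exists_finrank_ker_polarOp hJ hb
  have card_eq :
      (Nat.card (LinearMap.ker (polarOp J b)) : ℝ) = (Fintype.card K : ℝ) ^ (2 * s + 1) := by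
    rw [Module.natCard_eq_pow_finrank (K := K), hfinrank, Nat.card_eq_fintype_card, Nat.cast_pow]
  rw [inv_eq_sum_prod_sub_pow_odd (q := (Fintype.card K : ℝ))
      (Nat.cast_ne_zero.2 Fintype.card_ne_zero) (Nat.cast_ne_zero.2 Nat.card_pos.ne')
      (Fintype.card ι),
    prod_eq_zero (mem_range.2 hs) (sub_eq_zero.2 card_eq), mul_zero, zero_mul, add_zero]

end PolarPairing

section Moments

variable {K F ι : Type*} [Field K] [Field F] [Fintype F] [Algebra K F] [Fintype ι]
  {ρ : Gal(F/K)} {J : ι → Gal(F/K)} {ψ : AddChar F ℤ}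

open Classical in
lemma card_forall_polarOp_eq_zero_mul [DecidableEq ι] (hψ : ψ.IsPrimitive)
    (hψK : ∀ (g : Gal(F/K)) x, ψ (g x) = ψ x) {κ : Type*} [Fintype κ] (x : κ → F) :
    #{b : ι → F | ∀ i, polarOp J b (x i) = 0} * Fintype.card F ^ Fintype.card κ =
      Fintype.card F ^ Fintype.card ι * Nat.card {y : κ → F // IsPolarOrthogonal J x y} := by
  have sum_over_y (b : ι → F) : ∑ y : κ → F, ψ (∑ i, y i * polarOp J b (x i)) =
      if ∀ i, polarOp J b (x i) = 0 then (Fintype.card F : ℤ) ^ Fintype.card κ else 0 := by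
    rw [sum_pi_addChar_sum_mul hψ]
    exact if_congr funext_iff rfl rfl
  have sum_over_b (y : κ → F) : ∑ b : ι → F, ψ (∑ i, y i * polarOp J b (x i)) =
      if IsPolarOrthogonal J x y then (Fintype.card F : ℤ) ^ Fintype.card ι else 0 := by
    simp_rw [addChar_sum_mul_polarOp hψK]
    rw [sum_pi_addChar_sum_mul hψ]
    exact if_congr funext_iff rfl rfl
  have double_sum := sum_comm (s := (univ : Finset (ι → F))) (t := (univ : Finset (κ → F)))
    (f := fun b y => ψ (∑ i, y i * polarOp J b (x i)))
  simp_rw [sum_over_y, sum_over_b] at double_sum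
  rw [← sum_filter, ← sum_filter, sum_const, sum_const, nsmul_eq_mul, nsmul_eq_mul] at double_sum
  rw [Nat.card_eq_fintype_card, Fintype.card_subtype, mul_comm (_ ^ Fintype.card ι)]
  exact_mod_cast double_sum

variable [Fintype K] [CharP F 2]

open Classical in
lemma card_forall_polarOp_eq_zero [DecidableEq ι] (hJ : IsGoldFamily ρ J) (hψ : ψ.IsPrimitive)
    (hψK : ∀ (g : Gal(F/K)) x, ψ (g x) = ψ x) {r : ℕ} (hr : r ≤ Fintype.card ι) {x : Fin r → F}
    (hx : LinearIndependent K x) :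
    (#{b : ι → F | ∀ i, polarOp J b (x i) = 0} : ℝ) = (Fintype.card F : ℝ) ^ Fintype.card ι *
      ((Fintype.card F : ℝ)⁻¹ ^ r * (Fintype.card K : ℝ) ^ (r + 1).choose 2) := by
  have h := card_forall_polarOp_eq_zero_mul (J := J) hψ hψK x
  rw [natCard_isPolarOrthogonal hJ (by rwa [Fintype.card_fin]) hx, Fintype.card_fin,
    Nat.card_eq_fintype_card] at h
  rw [inv_pow, mul_left_comm, eq_inv_mul_iff_mul_eq₀
    (pow_ne_zero _ (Nat.cast_ne_zero.2 Fintype.card_ne_zero)), mul_comm]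
  exact_mod_cast h

lemma sum_prod_card_ker_sub_pow [DecidableEq ι] (hJ : IsGoldFamily ρ J) (hψ : ψ.IsPrimitive)
    (hψK : ∀ (g : Gal(F/K)) x, ψ (g x) = ψ x) {r : ℕ} (hr : r ≤ Fintype.card ι) :
    ∑ b : ι → F, ∏ j ∈ range r,
        ((Nat.card (LinearMap.ker (polarOp J b)) : ℝ) - (Fintype.card K : ℝ) ^ j) =
      (Fintype.card F : ℝ) ^ Fintype.card ι * ((Fintype.card F : ℝ)⁻¹ ^ r *
        (Fintype.card K : ℝ) ^ (r + 1).choose 2 *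
        ∏ j ∈ range r, ((Fintype.card F : ℝ) - (Fintype.card K : ℝ) ^ j)) := by
  classical
  have card_independent : (#{x : Fin r → F | LinearIndependent K x} : ℝ) =
      ∏ j ∈ range r, ((Fintype.card F : ℝ) - (Fintype.card K : ℝ) ^ j) := by
    rw [← Fintype.card_subtype, ← Nat.card_eq_fintype_card, natCard_linearIndependent_eq_prod ℝ,
      Nat.card_eq_fintype_card]
  calc _ = ∑ b : ι → F, (#{x : Fin r → F | LinearIndependent K x ∧
          ∀ i, x i ∈ LinearMap.ker (polarOp J b)} : ℝ) := by
        refine sum_congr rfl fun b _ => ?_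
        rw [← natCard_linearIndependent_eq_prod, natCard_linearIndependent_submodule]
    _ = ∑ b : ι → F, ∑ x : Fin r → F with LinearIndependent K x,
          (if ∀ i, polarOp J b (x i) = 0 then (1 : ℝ) else 0) := by
        refine sum_congr rfl fun b _ => ?_
        rw [← filter_filter, sum_boole]
        simp only [LinearMap.mem_ker]
    _ = ∑ x : Fin r → F with LinearIndependent K x,
          (#{b : ι → F | ∀ i, polarOp J b (x i) = 0} : ℝ) := by
        rw [sum_comm]
        exact sum_congr rfl fun x _ => sum_boole _ _
    _ = _ := by
        rw [sum_congr rfl fun x hx =>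
            card_forall_polarOp_eq_zero hJ hψ hψK hr (mem_filter.1 hx).2,
          sum_const, nsmul_eq_mul, card_independent]
        ring

lemma sum_prod_card_ker_sub_pow_odd [DecidableEq ι] (hJ : IsGoldFamily ρ J) (hψ : ψ.IsPrimitive)
    (hψK : ∀ (g : Gal(F/K)) x, ψ (g x) = ψ x) {u : ℕ} (hu : u ≤ Fintype.card ι) :
    ∑ b : ι → F, ∏ j ∈ range u,
        ((Nat.card (LinearMap.ker (polarOp J b)) : ℝ) - (Fintype.card K : ℝ) ^ (2 * j + 1)) =
      (Fintype.card F : ℝ) ^ Fintype.card ι * ((Fintype.card F : ℝ)⁻¹ ^ u *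
        ∏ j ∈ range u, ((Fintype.card F : ℝ) - (Fintype.card K : ℝ) ^ (2 * j + 1))) :=
  sum_prod_sub_pow_odd_of_sum_prod_sub_pow univ _
    (Nat.cast_ne_zero.2 Fintype.card_ne_zero) (Nat.cast_ne_zero.2 Fintype.card_ne_zero)
    (fun _ hr => sum_prod_card_ker_sub_pow hJ hψ hψK (Nat.le_of_lt_succ hr))
    (Nat.lt_succ_of_le hu)

omit [Fintype K] [CharP F 2] in
lemma natCard_ker_polarOp_zero :
    Nat.card (LinearMap.ker (polarOp J (0 : ι → F))) = Fintype.card F := by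
  have : polarOp J (0 : ι → F) = 0 := by
    ext x
    simp [polarOp_apply]
  rw [this, LinearMap.ker_zero, ← Nat.card_eq_fintype_card]
  exact Nat.card_congr Submodule.topEquiv.toEquiv

lemma card_mul_sum_erase_prod_card_ker_sub_pow_odd [DecidableEq ι] [DecidableEq F]
    (hJ : IsGoldFamily ρ J) (hψ : ψ.IsPrimitive) (hψK : ∀ (g : Gal(F/K)) x, ψ (g x) = ψ x)
    {u : ℕ} (hu : u ≤ Fintype.card ι) :
    (Fintype.card F : ℝ) * ∑ b ∈ univ.erase (0 : ι → F), ∏ j ∈ range u,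
        ((Nat.card (LinearMap.ker (polarOp J b)) : ℝ) - (Fintype.card K : ℝ) ^ (2 * j + 1)) =
      ((Fintype.card F : ℝ) ^ (Fintype.card ι + 1 - u) - Fintype.card F) *
        ∏ j ∈ range u, ((Fintype.card F : ℝ) - (Fintype.card K : ℝ) ^ (2 * j + 1)) := by
  have moment := sum_prod_card_ker_sub_pow_odd hJ hψ hψK hu
  rw [← add_sum_erase _ _ (mem_univ (0 : ι → F)), natCard_ker_polarOp_zero] at moment
  have pow_eq : (Fintype.card F : ℝ) ^ (Fintype.card ι + 1 - u) =
      Fintype.card F * ((Fintype.card F : ℝ) ^ Fintype.card ι * (Fintype.card F : ℝ)⁻¹ ^ u) := by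
    rw [Nat.sub_add_comm hu, pow_succ', pow_sub₀ _ (Nat.cast_ne_zero.2 Fintype.card_ne_zero) hu,
      inv_pow]
  rw [pow_eq]
  linear_combination (Fintype.card F : ℝ) * moment

lemma sum_card_div_card_ker [DecidableEq ι] (hJ : IsGoldFamily ρ J) (hψ : ψ.IsPrimitive)
    (hψK : ∀ (g : Gal(F/K)) x, ψ (g x) = ψ x) :
    ∑ b : ι → F, (Fintype.card F : ℝ) / Nat.card (LinearMap.ker (polarOp J b)) =
      1 + ∑ u ∈ range (Fintype.card ι), (-1) ^ u * ((Fintype.card K : ℝ) ^ ((u + 1) ^ 2))⁻¹ *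
        ((Fintype.card F : ℝ) ^ (Fintype.card ι + 1 - u) - Fintype.card F) *
        ∏ j ∈ range u, ((Fintype.card F : ℝ) - (Fintype.card K : ℝ) ^ (2 * j + 1)) := by
  classical
  rw [← add_sum_erase _ _ (mem_univ (0 : ι → F)), natCard_ker_polarOp_zero,
    div_self (Nat.cast_ne_zero.2 Fintype.card_ne_zero)]
  simp_rw [div_eq_mul_inv]
  rw [sum_congr rfl fun b hb => by rw [inv_card_ker_polarOp_eq_sum hJ (ne_of_mem_erase hb)],
    ← mul_sum, sum_comm, mul_sum]
  congr 1
  refine sum_congr rfl fun u hu => ?_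
  rw [← mul_sum, mul_left_comm,
    card_mul_sum_erase_prod_card_ker_sub_pow_odd hJ hψ hψK (mem_range.1 hu).le, mul_assoc _ (_ - _)]

end Moments

section Phase

variable {K F ι : Type*} [Field K] [Field F] [Algebra K F] [Finite F] [Fintype ι]
  {ψ : AddChar F ℤ} {J : ι → Gal(F/K)}

/-- The function `x ↦ b₀ * x + ∑ j, b j * (x * J j x)`. Its absolute traces over the powers of a
primitive element are the codewords. -/
def phase (J : ι → Gal(F/K)) (b₀ : F) (b : ι → F) (x : F) : F :=
  b₀ * x + ∑ j, b j * (x * J j x)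

lemma addChar_phase_add (hψK : ∀ (g : Gal(F/K)) x, ψ (g x) = ψ x) (b₀ : F) (b : ι → F)
    (x y : F) : ψ (phase J b₀ b (x + y)) =
      ψ (phase J b₀ b x) * ψ (phase J b₀ b y) * ψ (x * polarOp J b y) := by
  rw [addChar_mul_polarOp hψK, ← AddChar.map_add_eq_mul, ← AddChar.map_add_eq_mul]
  congr 1
  have sum_expand : ∑ j, b j * ((x + y) * (J j x + J j y)) = ∑ j, b j * (x * J j x) +
      ∑ j, b j * (y * J j y) + ∑ j, b j * (J j y * x + y * J j x) := by
    rw [← sum_add_distrib, ← sum_add_distrib]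
    exact sum_congr rfl fun j _ => by ring
  simp only [phase, map_add, sum_expand]
  ring

lemma eq_zero_of_forall_addChar_mul_eq_one {R R' : Type*} [CommRing R] [CommMonoid R']
    {ψ : AddChar R R'} (hψ : ψ.IsPrimitive) {a : R} (h : ∀ x, ψ (x * a) = 1) : a = 0 := by
  by_contra ha
  refine hψ ha ?_
  ext x
  rw [AddChar.mulShift_apply, mul_comm, h, AddChar.one_apply]

lemma eq_zero_of_forall_addChar_phase_eq_one [CharP F 2] {ρ : Gal(F/K)} (hJ : IsGoldFamily ρ J)
    (hψ : ψ.IsPrimitive) (hψK : ∀ (g : Gal(F/K)) x, ψ (g x) = ψ x) {b₀ : F} {b : ι → F}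
    (h : ∀ x, ψ (phase J b₀ b x) = 1) : b₀ = 0 ∧ b = 0 := by
  have polarOp_eq_zero : polarOp J b = 0 := LinearMap.ext fun y =>
    eq_zero_of_forall_addChar_mul_eq_one hψ fun x => by
      have := addChar_phase_add (J := J) hψK b₀ b x y
      rwa [h, h, h, one_mul, one_mul, eq_comm] at this
  have b_eq_zero : b = 0 := by
    by_contra hb
    have ker_le := finrank_ker_polarOp_le hJ hb
    rw [polarOp_eq_zero, LinearMap.ker_zero, finrank_top] at ker_le
    exact hJ.two_mul_card_lt.not_ge ker_le
  refine ⟨eq_zero_of_forall_addChar_mul_eq_one hψ fun x => ?_, b_eq_zero⟩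
  simpa [phase, b_eq_zero, mul_comm] using h x

end Phase

section ExpSum

variable {K F ι : Type*} [Field K] [Field F] [Fintype F] [Algebra K F] [Fintype ι]
  {ψ : AddChar F ℤ} {J : ι → Gal(F/K)}

/-- The exponential sum `∑ x, ψ (phase J b₀ b x)` of a quadratic phase function. -/
def expSum (ψ : AddChar F ℤ) (J : ι → Gal(F/K)) (b₀ : F) (b : ι → F) : ℤ :=
  ∑ x, ψ (phase J b₀ b x)

lemma addChar_mul_self {A M : Type*} [Ring A] [CharP A 2] [Monoid M] (ψ : AddChar A M) (x : A) :
    ψ x * ψ x = 1 := by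
  rw [← AddChar.map_add_eq_mul, CharTwo.add_self_eq_zero, AddChar.map_zero_eq_one]

lemma expSum_sq [CharP F 2] (hψ : ψ.IsPrimitive) (hψK : ∀ (g : Gal(F/K)) x, ψ (g x) = ψ x)
    (b₀ : F) (b : ι → F) [Fintype (LinearMap.ker (polarOp J b))] :
    expSum ψ J b₀ b ^ 2 =
      Fintype.card F * ∑ y : LinearMap.ker (polarOp J b), ψ (phase J b₀ b y) := by
  classical
  have translate (x : F) : ∑ y, ψ (phase J b₀ b y) = ∑ y, ψ (phase J b₀ b (x + y)) :=
    (Equiv.sum_comp (Equiv.addLeft x) fun y => ψ (phase J b₀ b y)).symm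
  calc _ = ∑ x, ψ (phase J b₀ b x) * ∑ y, ψ (phase J b₀ b (x + y)) := by
        rw [expSum, sq, sum_mul]
        exact sum_congr rfl fun x _ => by rw [← translate x]
    _ = ∑ x, ∑ y, ψ (phase J b₀ b y) * ψ (x * polarOp J b y) := by
        refine sum_congr rfl fun x _ => ?_
        rw [mul_sum]
        refine sum_congr rfl fun y _ => ?_
        rw [addChar_phase_add hψK, ← mul_assoc, ← mul_assoc, addChar_mul_self, one_mul]
    _ = ∑ y, ψ (phase J b₀ b y) * (if polarOp J b y = 0 then (Fintype.card F : ℤ) else 0) := by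
        rw [sum_comm]
        refine sum_congr rfl fun y _ => ?_
        rw [← mul_sum, AddChar.sum_mulShift _ hψ, Nat.cast_ite, Nat.cast_zero]
    _ = ∑ y with y ∈ LinearMap.ker (polarOp J b), ψ (phase J b₀ b y) * Fintype.card F := by
        rw [sum_filter]
        exact sum_congr rfl fun y _ => mul_ite_zero _ _ _
    _ = _ := by
        rw [← sum_mul, mul_comm, sum_subtype (p := (· ∈ LinearMap.ker (polarOp J b))) _ (by simp)]

/-- The phase is additive on the kernel of the polar operator. -/
lemma expSum_sq_eq_ite [CharP F 2] (hψ : ψ.IsPrimitive)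
    (hψK : ∀ (g : Gal(F/K)) x, ψ (g x) = ψ x) (b₀ : F) (b : ι → F) :
    expSum ψ J b₀ b ^ 2 = if expSum ψ J b₀ b = 0 then 0 else
      (Fintype.card F : ℤ) * Nat.card (LinearMap.ker (polarOp J b)) := by
  classical
  split_ifs with h
  · rw [h, zero_pow two_ne_zero]
  let χ : AddChar (LinearMap.ker (polarOp J b)) ℤ :=
    { toFun := fun y => ψ (phase J b₀ b y)
      map_zero_eq_one' := by simp [phase]
      map_add_eq_mul' := fun x y => by
        rw [Submodule.coe_add, addChar_phase_add hψK, LinearMap.mem_ker.1 y.2, mul_zero,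
          AddChar.map_zero_eq_one, mul_one] }
  have expSum_sq_eq : expSum ψ J b₀ b ^ 2 = Fintype.card F * ∑ y, χ y := expSum_sq hψ hψK b₀ b
  have sum_ne_zero : ∑ y, χ y ≠ 0 := fun hχ =>
    h (sq_eq_zero_iff.1 (expSum_sq_eq.trans (by rw [hχ, mul_zero])))
  rw [expSum_sq_eq, AddChar.sum_eq_ite, if_pos (AddChar.sum_ne_zero_iff_eq_zero.1 sum_ne_zero),
    Nat.card_eq_fintype_card]

lemma sum_expSum_sq [CharP F 2] (hψ : ψ.IsPrimitive) (hψK : ∀ (g : Gal(F/K)) x, ψ (g x) = ψ x)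
    (b : ι → F) : ∑ b₀, expSum ψ J b₀ b ^ 2 = (Fintype.card F : ℤ) ^ 2 := by
  classical
  simp_rw [expSum_sq hψ hψK]
  rw [← mul_sum, sum_comm, sq]
  have sum_over_b₀ (y : LinearMap.ker (polarOp J b)) :
      ∑ b₀, ψ (phase J b₀ b y) = if y = 0 then (Fintype.card F : ℤ) else 0 := by
    simp only [phase, AddChar.map_add_eq_mul]
    rw [← sum_mul, AddChar.sum_mulShift _ hψ]
    by_cases hy : y = 0
    · simp [hy]
    · simp [hy]
  simp [sum_over_b₀]

lemma card_expSum_ne_zero_mul [CharP F 2] (hψ : ψ.IsPrimitive)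
    (hψK : ∀ (g : Gal(F/K)) x, ψ (g x) = ψ x) (b : ι → F) :
    #{b₀ : F | expSum ψ J b₀ b ≠ 0} * Nat.card (LinearMap.ker (polarOp J b)) =
      Fintype.card F := by
  have card_ne_zero : (Fintype.card F : ℤ) ≠ 0 := Nat.cast_ne_zero.2 Fintype.card_ne_zero
  have second_moment := sum_expSum_sq (J := J) hψ hψK b
  simp_rw [expSum_sq_eq_ite hψ hψK, ← ite_not (expSum ψ J _ b = 0)] at second_moment
  rw [← sum_filter, sum_const, nsmul_eq_mul, mul_left_comm, sq] at second_moment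
  exact_mod_cast mul_left_cancel₀ card_ne_zero second_moment

lemma card_expSum_eq_zero [DecidableEq ι] [Fintype K] [CharP F 2] {ρ : Gal(F/K)}
    (hJ : IsGoldFamily ρ J) (hψ : ψ.IsPrimitive) (hψK : ∀ (g : Gal(F/K)) x, ψ (g x) = ψ x) :
    (#{p : F × (ι → F) | expSum ψ J p.1 p.2 = 0} : ℝ) =
      (Fintype.card F : ℝ) ^ (Fintype.card ι + 1) - 1 -
        ∑ u ∈ range (Fintype.card ι), (-1) ^ u * ((Fintype.card K : ℝ) ^ ((u + 1) ^ 2))⁻¹ *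
          ((Fintype.card F : ℝ) ^ (Fintype.card ι + 1 - u) - Fintype.card F) *
          ∏ j ∈ range u, ((Fintype.card F : ℝ) - (Fintype.card K : ℝ) ^ (2 * j + 1)) := by
  have card_add : (#{p : F × (ι → F) | expSum ψ J p.1 p.2 = 0} : ℝ) +
      #{p : F × (ι → F) | expSum ψ J p.1 p.2 ≠ 0} =
        (Fintype.card F : ℝ) ^ (Fintype.card ι + 1) := by
    have := card_filter_add_card_filter_not (s := (univ : Finset (F × (ι → F))))
      (fun p => expSum ψ J p.1 p.2 = 0)
    rw [card_univ, Fintype.card_prod, Fintype.card_fun, ← pow_succ'] at this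
    exact_mod_cast this
  have card_ne_zero : (#{p : F × (ι → F) | expSum ψ J p.1 p.2 ≠ 0} : ℝ) =
      ∑ b : ι → F, (Fintype.card F : ℝ) / Nat.card (LinearMap.ker (polarOp J b)) := by
    rw [← sum_boole, Fintype.sum_prod_type_right]
    refine sum_congr rfl fun b _ => ?_
    rw [sum_boole, eq_div_iff (Nat.cast_ne_zero.2 Nat.card_pos.ne')]
    exact_mod_cast card_expSum_ne_zero_mul (J := J) hψ hψK b
  rw [card_ne_zero, sum_card_div_card_ker hJ hψ hψK] at card_add
  linear_combination card_add

end ExpSum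

section ZPowInterval

variable {G : Type*} [Group G] {ρ : G}

lemma zpow_mem_zpowInterval {w a : ℤ} {N : ℕ} (h₁ : w ≤ a) (h₂ : a ≤ w + N) :
    ρ ^ a ∈ zpowInterval ρ w N :=
  ⟨(a - w).toNat, by omega, by congr 1; omega⟩

lemma exists_zpow_eq_of_mem_zpowers (hρ : 0 < orderOf ρ) {g : G} (hg : g ∈ Subgroup.zpowers ρ)
    (a : ℤ) : ∃ c, a ≤ c ∧ c < a + orderOf ρ ∧ ρ ^ c = g := by
  obtain ⟨b, rfl⟩ := hg
  have order_pos : (0 : ℤ) < orderOf ρ := by exact_mod_cast hρ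
  have nonneg := Int.emod_nonneg (b - a) order_pos.ne'
  have lt := Int.emod_lt_of_pos (b - a) order_pos
  refine ⟨a + (b - a) % orderOf ρ, by omega, by omega, ?_⟩
  rw [zpow_add, zpow_mod_orderOf, ← zpow_add, add_sub_cancel]

end ZPowInterval

section Families

variable {K F : Type*} [Field K] [Field F] [Algebra K F] {ρ : Gal(F/K)}

lemma IsGoldFamily.inv {ι : Type*} [Fintype ι] {J : ι → Gal(F/K)} (hJ : IsGoldFamily ρ J) :
    IsGoldFamily ρ (fun i => (J i)⁻¹) where
  gen := hJ.gen
  two_mul_card_lt := hJ.two_mul_card_lt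
  odd_finrank := hJ.odd_finrank
  inj := inv_injective.comp hJ.inj
  ne_inv i j h := hJ.ne_inv j i (by simpa using h.symm)
  window := by
    obtain ⟨w, hw⟩ := hJ.window
    exact ⟨w, fun i => ⟨(hw i).2, by simpa using (hw i).1⟩⟩
  cowindow := by
    obtain ⟨w, hw⟩ := hJ.cowindow
    refine ⟨w, fun g g_ne_one hg hg_inv => hw g g_ne_one ?_ ?_⟩
    · rintro ⟨i, rfl⟩
      exact hg_inv ⟨i, rfl⟩
    · rintro ⟨i, hi⟩
      exact hg ⟨i, by simp [hi]⟩

variable [FiniteDimensional K F] [IsGalois K F]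

lemma zpow_ne_zpow_of_lt_finrank (gen : ∀ g, g ∈ Subgroup.zpowers ρ) {a b : ℤ} (hab : a < b)
    (h : b < a + finrank K F) : ρ ^ a ≠ ρ ^ b := by
  rw [ne_eq, zpow_eq_zpow_iff_modEq, orderOf_eq_finrank_of_forall_mem_zpowers gen,
    Int.modEq_iff_dvd]
  exact fun hdvd => absurd (Int.le_of_dvd (by omega) hdvd) (by omega)

lemma zpow_inv_eq_zpow_of_add_eq_finrank (gen : ∀ g, g ∈ Subgroup.zpowers ρ) {a b : ℤ}
    (h : a + b = finrank K F) : (ρ ^ a)⁻¹ = ρ ^ b := by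
  rw [inv_eq_iff_mul_eq_one, ← zpow_add, h, zpow_natCast,
    ← orderOf_eq_finrank_of_forall_mem_zpowers gen, pow_orderOf_eq_one]

variable {n : ℕ}

lemma isGoldFamily_consecutive (gen : ∀ g, g ∈ Subgroup.zpowers ρ) (hn : 2 * n < finrank K F)
    (hodd : Odd (finrank K F)) : IsGoldFamily ρ (fun i : Fin n => ρ ^ (i + 1 : ℤ)) where
  gen := gen
  two_mul_card_lt := by rwa [Fintype.card_fin]
  odd_finrank := hodd
  inj i j h := by
    by_contra hij
    rcases lt_or_gt_of_ne hij with hlt | hlt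
    · exact zpow_ne_zpow_of_lt_finrank gen (by omega) (by omega) h
    · exact zpow_ne_zpow_of_lt_finrank gen (by omega) (by omega) h.symm
  ne_inv i j h := by
    rw [← zpow_neg] at h
    exact zpow_ne_zpow_of_lt_finrank gen (by omega) (by omega) h.symm
  window := by
    rw [Fintype.card_fin]
    refine ⟨-n, fun i => ⟨zpow_mem_zpowInterval (by omega) (by omega), ?_⟩⟩
    rw [← zpow_neg]
    exact zpow_mem_zpowInterval (by omega) (by omega)
  cowindow := by
    rw [Fintype.card_fin]
    refine ⟨n + 1, fun g g_ne_one hg hg_inv => ?_⟩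
    obtain ⟨c, c_nonneg, c_lt, rfl⟩ :=
      exists_zpow_eq_of_mem_zpowers (orderOf_pos ρ) (gen g) 0
    rw [orderOf_eq_finrank_of_forall_mem_zpowers gen] at c_lt
    have c_ne_zero : c ≠ 0 := by
      rintro rfl
      exact g_ne_one (zpow_zero ρ)
    have lt_c : n < c := by
      by_contra hle
      exact hg ⟨⟨(c - 1).toNat, by omega⟩, congrArg (ρ ^ ·) (by push_cast; omega)⟩
    have c_lt_sub : c < finrank K F - n := by
      by_contra hle
      rw [zpow_inv_eq_zpow_of_add_eq_finrank gen (b := finrank K F - c) (by ring)] at hg_inv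
      exact hg_inv ⟨⟨(finrank K F - c - 1).toNat, by omega⟩,
        congrArg (ρ ^ ·) (by push_cast; omega)⟩
    exact zpow_mem_zpowInterval (by omega) (by omega)

lemma isGoldFamily_central (gen : ∀ g, g ∈ Subgroup.zpowers ρ) {t : ℕ}
    (ht : finrank K F = 2 * t + 1) (hn : n ≤ t) :
    IsGoldFamily ρ (fun i : Fin n => ρ ^ (t - i : ℤ)) where
  gen := gen
  two_mul_card_lt := by rw [Fintype.card_fin]; omega
  odd_finrank := ⟨t, ht⟩
  inj i j h := by
    by_contra hij
    rcases lt_or_gt_of_ne hij with hlt | hlt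
    · exact zpow_ne_zpow_of_lt_finrank gen (by omega) (by omega) h.symm
    · exact zpow_ne_zpow_of_lt_finrank gen (by omega) (by omega) h
  ne_inv i j h := by
    rw [← zpow_neg] at h
    exact zpow_ne_zpow_of_lt_finrank gen (by omega) (by omega) h.symm
  window := by
    rw [Fintype.card_fin]
    refine ⟨t - n + 1, fun i => ⟨zpow_mem_zpowInterval (by omega) (by omega), ?_⟩⟩
    rw [zpow_inv_eq_zpow_of_add_eq_finrank gen (b := t + 1 + i) (by omega)]
    exact zpow_mem_zpowInterval (by omega) (by omega)
  cowindow := by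
    rw [Fintype.card_fin]
    refine ⟨-(t - n), fun g _ hg hg_inv => ?_⟩
    obtain ⟨c, c_ge, c_lt, rfl⟩ :=
      exists_zpow_eq_of_mem_zpowers (orderOf_pos ρ) (gen g) (-t)
    rw [orderOf_eq_finrank_of_forall_mem_zpowers gen] at c_lt
    have c_le : c ≤ t - n := by
      by_contra hlt
      exact hg ⟨⟨(t - c).toNat, by omega⟩, congrArg (ρ ^ ·) (by push_cast; omega)⟩
    have neg_le_c : -(t - n) ≤ c := by
      by_contra hlt
      rw [← zpow_neg] at hg_inv
      exact hg_inv ⟨⟨(t + c).toNat, by omega⟩, congrArg (ρ ^ ·) (by push_cast; omega)⟩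
    exact zpow_mem_zpowInterval (by omega) (by omega)

end Families

section OddOrder

variable {K F : Type*} [Field K] [Field F] [Algebra K F] [CharP F 2] {g : Gal(F/K)}

lemma eq_one_of_mul_galois_eq_one (hg : Odd (orderOf g)) {x : F} (hx : x * g x = 1) : x = 1 := by
  have g_apply : g x = x⁻¹ := eq_inv_of_mul_eq_one_right hx
  have g_sq_mem : g ^ 2 ∈ MulAction.stabilizer Gal(F/K) x := by
    rw [MulAction.mem_stabilizer_iff, AlgEquiv.smul_def, pow_two, AlgEquiv.mul_apply, g_apply,
      map_inv₀, g_apply, inv_inv]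
  have g_mem : g ∈ MulAction.stabilizer Gal(F/K) x := by
    obtain ⟨t, ht⟩ := hg
    have g_eq : (g ^ 2) ^ (t + 1) = g := by
      rw [← pow_mul, show 2 * (t + 1) = orderOf g + 1 by omega, pow_succ, pow_orderOf_eq_one,
        one_mul]
    exact g_eq ▸ pow_mem g_sq_mem (t + 1)
  have g_fixes : g x = x := g_mem
  rw [g_fixes] at hx
  rw [← sub_eq_zero, ← mul_self_eq_zero, CharTwo.sub_eq_add, CharTwo.add_mul_self, hx, one_mul,
    CharTwo.add_self_eq_zero]

lemma mul_galois_injective (hg : Odd (orderOf g)) : Function.Injective fun x : F => x * g x := by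
  intro x y hxy
  beta_reduce at hxy
  rcases eq_or_ne y 0 with rfl | hy
  · simpa using hxy
  · have hgy : g y ≠ 0 := (map_ne_zero g).2 hy
    refine (div_eq_one_iff_eq hy).1 (eq_one_of_mul_galois_eq_one hg ?_)
    rw [map_div₀, div_mul_div_comm, hxy, div_self (mul_ne_zero hy hgy)]

end OddOrder

section FixedField

lemma exists_intermediateField_gen {k F : Type*} [Field k] [Field F] [Algebra k F]
    [FiniteDimensional k F] (σ : Gal(F/k)) :
    ∃ (K : IntermediateField k F) (ρ : Gal(F/K)), finrank K F = orderOf σ ∧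
      (∀ x, ρ x = σ x) ∧ ∀ g, g ∈ Subgroup.zpowers ρ := by
  let Φ := IntermediateField.subgroupEquivAlgEquiv (Subgroup.zpowers σ)
  refine ⟨IntermediateField.fixedField (Subgroup.zpowers σ),
    Φ ⟨σ, Subgroup.mem_zpowers σ⟩, ?_, fun x => rfl, fun g => ?_⟩
  · rw [IntermediateField.finrank_fixedField_eq_card, Nat.card_zpowers]
  · obtain ⟨⟨_, i, rfl⟩, rfl⟩ := Φ.surjective g
    exact ⟨i, (map_zpow Φ _ i).symm⟩

lemma exists_intermediateField_frobenius_gen {F : Type*} [Field F] [Finite F]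
    [Algebra (ZMod 2) F] {m : ℕ} (hF : Nat.card F = 2 ^ m) (d : ℕ) :
    ∃ (K : IntermediateField (ZMod 2) F) (ρ : Gal(F/K)), Nat.card K = 2 ^ m.gcd d ∧
      finrank K F = m / m.gcd d ∧ (∀ x, ρ x = x ^ 2 ^ d) ∧ ∀ g, g ∈ Subgroup.zpowers ρ := by
  have finrank_eq : finrank (ZMod 2) F = m := by
    rw [Module.natCard_eq_pow_finrank (K := ZMod 2), Nat.card_zmod] at hF
    exact Nat.pow_right_injective le_rfl hF
  have m_pos : 0 < m := finrank_eq ▸ finrank_pos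
  let φ : Gal(F/ZMod 2) := FiniteField.frobeniusAlgEquivOfAlgebraic (ZMod 2) F
  obtain ⟨K, ρ, finrank_K, hρ, gen⟩ := exists_intermediateField_gen (φ ^ d)
  rw [orderOf_pow, FiniteField.orderOf_frobeniusAlgEquivOfAlgebraic, finrank_eq] at finrank_K
  refine ⟨K, ρ, ?_, finrank_K, fun x => ?_, gen⟩
  · have tower := finrank_mul_finrank (ZMod 2) K F
    rw [finrank_eq, finrank_K] at tower
    rw [Module.natCard_eq_pow_finrank (K := ZMod 2), Nat.card_zmod]
    congr 1
    have m_div_pos : 0 < m / m.gcd d :=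
      Nat.div_pos (Nat.gcd_le_left d m_pos) (Nat.gcd_pos_of_pos_left d m_pos)
    exact Nat.eq_of_mul_eq_mul_right m_div_pos
      (tower.trans (Nat.mul_div_cancel' (Nat.gcd_dvd_left m d)).symm)
  · rw [hρ, AlgEquiv.coe_pow, FiniteField.coe_frobeniusAlgEquivOfAlgebraic_iterate, ZMod.card]

end FixedField

section Systems

variable {m d e k : ℕ}

lemma Parameters.exists_odd (h : Parameters m d e k) :
    ∃ t, m = e * (2 * t + 1) ∧ k ≤ t + 1 ∧ 0 < e ∧ e ∣ d := by
  have e_pos : 0 < e := h.gcd_eq ▸ Nat.gcd_pos_of_pos_left _ h.m_pos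
  have e_dvd : e ∣ d := h.gcd_eq ▸ Nat.gcd_dvd_right m d
  obtain ⟨n, hn⟩ : e ∣ m := h.gcd_eq ▸ Nat.gcd_dvd_left m d
  rcases n.even_or_odd with ⟨t, ht⟩ | ⟨t, ht⟩
  · have two_mul_dvd : 2 * e ∣ e := by
      nth_rw 2 [h.gcd_two_eq]
      exact Nat.dvd_gcd ⟨t, by rw [hn, ht]; ring⟩ (Nat.mul_dvd_mul_left 2 e_dvd)
    have := Nat.le_of_dvd e_pos two_mul_dvd
    omega
  · refine ⟨t, by rw [hn, ht], ?_, e_pos, e_dvd⟩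
    refine Nat.le_of_mul_le_mul_left (h.le_bound.trans_eq ?_) (by omega : 0 < 2 * e)
    rw [hn, ht]
    ring

lemma pow_pow_add_mul_of_natCard {F : Type*} [Field F] [Finite F] {p : ℕ}
    (hF : Nat.card F = p ^ m) (x : F) (a c : ℕ) : x ^ p ^ (a + m * c) = x ^ p ^ a := by
  have := Fintype.ofFinite F
  rw [pow_add, pow_mul, pow_mul p m, ← hF, Nat.card_eq_fintype_card, FiniteField.pow_card_pow]

variable {F : Type*} [Field F]

lemma pow_galois_apply {K : Type*} [Field K] [Algebra K F] {ρ : Gal(F/K)} {q : ℕ}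
    (hρ : ∀ x, ρ x = x ^ q) (i : ℕ) (x : F) : (ρ ^ i) x = x ^ q ^ i := by
  induction i generalizing x with
  | zero => simp
  | succ i ih => rw [pow_succ, AlgEquiv.mul_apply, hρ, ih, ← pow_mul, ← pow_succ']

lemma exists_isGoldFamily [Finite F] [Algebra (ZMod 2) F] (h : Parameters m d e k)
    (hF : Nat.card F = 2 ^ m) (S : System) :
    ∃ (K : IntermediateField (ZMod 2) F) (ρ : Gal(F/K)) (J : Fin (k - 1) → Gal(F/K)),
      Nat.card K = 2 ^ e ∧ IsGoldFamily ρ J ∧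
        ∀ i x, x * J i x = x ^ S.factor m d e (i + 1) := by
  obtain ⟨t, hm, hkt, e_pos, c, rfl⟩ := h.exists_odd
  have hn : m / e = 2 * t + 1 := by rw [hm, Nat.mul_div_cancel_left _ e_pos]
  obtain ⟨K, ρ, card_K, finrank_K, hρ, gen⟩ :=
    exists_intermediateField_frobenius_gen hF (e * c)
  rw [← h.gcd_eq] at card_K finrank_K
  rw [hn] at finrank_K
  cases S with
  | consecutive =>
    refine ⟨K, ρ, _, card_K, isGoldFamily_consecutive gen (by omega) ⟨t, finrank_K⟩, fun i x => ?_⟩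
    rw [← Nat.cast_succ, zpow_natCast, pow_galois_apply hρ, System.factor, ← pow_mul 2,
      mul_comm (e * c), pow_succ' x]
  | odd =>
    obtain ⟨K', ρ', card_K', finrank_K', hρ', gen'⟩ :=
      exists_intermediateField_frobenius_gen hF (2 * (e * c))
    rw [← h.gcd_two_eq] at card_K' finrank_K'
    rw [hn] at finrank_K'
    refine ⟨K', ρ', _, card_K', (isGoldFamily_central gen' finrank_K' (by omega)).inv,
      fun i x => ?_⟩
    rw [zpow_inv_eq_zpow_of_add_eq_finrank gen' (b := (t + 1 + i : ℕ)) (by omega), zpow_natCast,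
      pow_galois_apply hρ', System.factor, pow_succ', ← pow_mul 2,
      ← pow_pow_add_mul_of_natCard hF x ((2 * (i + 1) - 1) * (e * c)) c, hm,
      show 2 * ((i : ℕ) + 1) - 1 = 2 * i + 1 by omega]
    ring_nf
  | descending =>
    refine ⟨K, ρ, _, card_K, isGoldFamily_central gen finrank_K (n := k - 1) (by omega),
      fun i x => ?_⟩
    have quotient_eq : (m + e) / (2 * e) = t + 1 :=
      Nat.div_eq_of_eq_mul_left (by omega) (by rw [hm]; ring)
    rw [← Nat.cast_sub (by omega), zpow_natCast, pow_galois_apply hρ, System.factor, pow_succ',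
      quotient_eq, Nat.add_sub_add_right, ← pow_mul 2, mul_comm (e * c)]

end Systems

section Annihilator

open Polynomial

variable {k V : Type*} [Field k] [AddCommGroup V] [Module k V]

/-- The ideal of the polynomials `f` such that `f(T) v = 0`. For the shift operator `T`, these are
the linear recurrences satisfied by the sequence `v`. -/
noncomputable def annihilatorAt (T : Module.End k V) (v : V) : Ideal k[X] :=
  Ideal.torsionOf k[X] (AEval' T) (AEval'.of T v)

variable {T : Module.End k V} {v : V}

lemma mem_annihilatorAt {f : k[X]} : f ∈ annihilatorAt T v ↔ aeval T f v = 0 := by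
  rw [annihilatorAt, Ideal.mem_torsionOf_iff, ← AEval.of_aeval_smul, LinearEquiv.map_eq_zero_iff,
    Module.End.smul_def]

lemma exists_linearMap_quotient_annihilatorAt (φ : V →ₗ[k] k) :
    ∃ ℓ : k[X] ⧸ annihilatorAt T v →ₗ[k] k,
      ∀ f, ℓ (Ideal.Quotient.mk _ f) = φ (aeval T f v) := by
  let eval : k[X] →ₗ[k] k := φ ∘ₗ LinearMap.applyₗ v ∘ₗ (aeval T).toLinearMap
  have le_ker : (annihilatorAt T v).restrictScalars k ≤ LinearMap.ker eval := fun f hf => by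
    simp [eval, mem_annihilatorAt.1 hf]
  exact ⟨Submodule.liftQ _ eval le_ker ∘ₗ
    (Submodule.Quotient.restrictScalarsEquiv k (annihilatorAt T v)).symm.toLinearMap, fun f => rfl⟩

lemma finite_quotient_of_monic_mem [Finite k] {I : Ideal k[X]} {p : k[X]} (hp : p.Monic)
    (hpI : p ∈ I) :
    Finite (k[X] ⧸ I) ∧ Nat.card (k[X] ⧸ I) ≤ Nat.card k ^ p.natDegree := by
  let basis := AdjoinRoot.powerBasis' hp
  have := basis.finite
  have : Finite (k[X] ⧸ Ideal.span {p}) := Module.finite_of_finite k (M := AdjoinRoot p)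
  have factor_surjective :=
    Ideal.Quotient.factor_surjective ((Ideal.span_singleton_le_iff_mem I).2 hpI)
  refine ⟨Finite.of_surjective _ factor_surjective,
    (Nat.card_le_card_of_surjective _ factor_surjective).trans_eq ?_⟩
  change Nat.card (AdjoinRoot p) = _
  rw [Module.natCard_eq_pow_finrank (K := k), basis.finrank, AdjoinRoot.powerBasis'_dim]

end Annihilator

section FiniteRings

lemma ncard_powers {M : Type*} [Monoid M] {a : M} (ha : IsOfFinOrder a) :
    (Submonoid.powers a : Set M).ncard = orderOf a := by
  rw [← Nat.card_coe_set_eq]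
  exact (Nat.card_congr (finEquivPowers ha).symm).trans (Nat.card_fin _)

variable {R : Type*} [CommRing R] [Nontrivial R] [Finite R] {a : R}

lemma powers_eq_compl_zero_of_card_le (ha : IsOfFinOrder a) (hcard : Nat.card R ≤ orderOf a + 1) :
    (Submonoid.powers a : Set R) = {0}ᶜ := by
  refine Set.eq_of_subset_of_ncard_le ?_ ?_
  · rintro _ ⟨n, rfl⟩
    exact (ha.isUnit.pow n).ne_zero
  · rw [ncard_powers ha, Set.ncard_compl, Set.ncard_singleton]
    omega

lemma isField_of_card_le (ha : IsOfFinOrder a) (hcard : Nat.card R ≤ orderOf a + 1) :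
    IsField R where
  exists_pair_ne := exists_pair_ne R
  mul_comm := mul_comm
  mul_inv_cancel {x} hx := by
    rw [← Set.mem_compl_singleton_iff, ← powers_eq_compl_zero_of_card_le ha hcard] at hx
    obtain ⟨n, rfl⟩ := hx
    exact (ha.isUnit.pow n).exists_right_inv

lemma card_eq_of_card_le (ha : IsOfFinOrder a) (hcard : Nat.card R ≤ orderOf a + 1) :
    Nat.card R = orderOf a + 1 := by
  have card_powers := ncard_powers ha
  rw [powers_eq_compl_zero_of_card_le ha hcard, Set.ncard_compl, Set.ncard_singleton]
    at card_powers
  have := Nat.card_pos (α := R)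
  omega

end FiniteRings

lemma exists_eq_trace_mul {k F : Type*} [Field k] [Field F] [Algebra k F] [FiniteDimensional k F]
    [Algebra.IsSeparable k F] (ℓ : F →ₗ[k] k) : ∃ β, ∀ x, ℓ x = Algebra.trace k F (β * x) :=
  ⟨((Algebra.traceForm k F).toDual (traceForm_nondegenerate k F)).symm ℓ, fun x =>
    (LinearMap.BilinForm.apply_toDual_symm_apply (hB := traceForm_nondegenerate k F) ℓ x).symm⟩

section Sequences

open Polynomial

/-- The one-step shift as a linear operator on binary sequences. -/
def shiftOp (m : ℕ) : Module.End (ZMod 2) (BinSeq m) := LinearMap.funLeft _ _ (· + 1)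

variable {m : ℕ} {s : BinSeq m}

lemma shiftOp_pow_apply (n : ℕ) : (shiftOp m ^ n) s = shift n s := by
  induction n with
  | zero => exact funext fun i => by simp [shift]
  | succ n ih =>
    rw [pow_succ', Module.End.mul_apply, ih]
    funext i
    simp [shiftOp, LinearMap.funLeft_apply, shift, add_assoc, add_comm (1 : ZMod _)]

lemma exists_monic_mem_annihilatorAt (hs : IsMaxLength m s) :
    ∃ p ∈ annihilatorAt (shiftOp m) s, p.Monic ∧ p.natDegree = m := by
  obtain ⟨⟨a, recurrence⟩, -⟩ := hs
  let r : (ZMod 2)[X] := ∑ j : Fin m, C (a j) * X ^ (j : ℕ)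
  have degree_lt : r.degree < m := degree_sum_fin_lt a
  refine ⟨X ^ m - r, ?_, monic_X_pow_sub degree_lt, ?_⟩
  · rw [mem_annihilatorAt]
    funext i
    simp only [r, map_sub, map_pow, aeval_X, map_sum, map_mul, aeval_C, LinearMap.sub_apply,
      LinearMap.sum_apply, Pi.sub_apply, Finset.sum_apply, Pi.zero_apply, Module.End.mul_apply,
      Module.algebraMap_end_apply, Pi.smul_apply, smul_eq_mul, shiftOp_pow_apply, shift]
    rw [recurrence, sub_self]
  · refine natDegree_eq_of_degree_eq_some ?_
    rw [degree_sub_eq_left_of_degree_lt (by rwa [degree_X_pow]), degree_X_pow]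

lemma orderOf_mk_X (hs : IsMaxLength m s) :
    orderOf (Ideal.Quotient.mk (annihilatorAt (shiftOp m) s) X) = 2 ^ m - 1 := by
  refine Nat.dvd_right_iff_eq.1 fun n => ?_
  rw [orderOf_dvd_iff_pow_eq_one, ← map_pow, ← map_one (Ideal.Quotient.mk _),
    Ideal.Quotient.mk_eq_mk_iff_sub_mem, mem_annihilatorAt, map_sub, map_one, map_pow, aeval_X,
    LinearMap.sub_apply, shiftOp_pow_apply, Module.End.one_apply, sub_eq_zero,
    ← ZMod.natCast_eq_zero_iff]
  constructor
  · exact fun hshift => hs.2 n (congrFun hshift)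
  · intro hn
    exact funext fun i => by simp [hn, shift]

lemma IsMaxLength.ne_zero (hm : 2 ≤ m) (hs : IsMaxLength m s) : s ≠ 0 := by
  rintro rfl
  have : Fact (1 < 2 ^ m - 1) := ⟨by have := Nat.pow_le_pow_right two_pos hm; omega⟩
  exact one_ne_zero (hs.2 1 fun i => rfl)

lemma exists_trace_representation (hm : 2 ≤ m) (hs : IsMaxLength m s) :
    ∃ (F : Type) (_ : Field F) (_ : Finite F) (_ : Algebra (ZMod 2) F) (α β : F),
      Nat.card F = 2 ^ m ∧ IsPrimitiveRoot α (2 ^ m - 1) ∧ β ≠ 0 ∧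
        ∀ i : ℕ, s i = Algebra.trace (ZMod 2) F (β * α ^ i) := by
  let I := annihilatorAt (shiftOp m) s
  let α := Ideal.Quotient.mk I X
  have four_le := Nat.pow_le_pow_right two_pos hm
  obtain ⟨p, hpI, hp, natDegree_p⟩ := exists_monic_mem_annihilatorAt hs
  obtain ⟨_, card_le⟩ := finite_quotient_of_monic_mem hp hpI
  have orderOf_α : orderOf α = 2 ^ m - 1 := orderOf_mk_X hs
  rw [Nat.card_zmod, natDegree_p] at card_le
  replace card_le : Nat.card ((ZMod 2)[X] ⧸ I) ≤ orderOf α + 1 := card_le.trans (by omega)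
  have : Nontrivial ((ZMod 2)[X] ⧸ I) := by
    refine Ideal.Quotient.nontrivial_iff.2 fun I_eq_top => hs.ne_zero hm ?_
    simpa using mem_annihilatorAt.1 ((Ideal.eq_top_iff_one I).1 I_eq_top)
  have finOrder_α : IsOfFinOrder α := orderOf_pos_iff.1 (by omega)
  let _ : Field ((ZMod 2)[X] ⧸ I) := (isField_of_card_le finOrder_α card_le).toField
  obtain ⟨ℓ, hℓ⟩ := exists_linearMap_quotient_annihilatorAt (T := shiftOp m) (v := s)
    (LinearMap.proj 0)
  have ℓ_pow (i : ℕ) : ℓ (α ^ i) = s i := by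
    rw [← map_pow, hℓ, map_pow, aeval_X, shiftOp_pow_apply, LinearMap.proj_apply, shift, zero_add]
  obtain ⟨β, hβ⟩ := exists_eq_trace_mul ℓ
  refine ⟨(ZMod 2)[X] ⧸ I, inferInstance, inferInstance, inferInstance, α, β, ?_,
    orderOf_α ▸ IsPrimitiveRoot.orderOf α, ?_, fun i => by rw [← ℓ_pow, hβ]⟩
  · rw [card_eq_of_card_le finOrder_α card_le]
    omega
  · rintro rfl
    have : NeZero (2 ^ m - 1) := ⟨by omega⟩
    refine hs.ne_zero hm (funext fun i => ?_)
    rw [← ZMod.natCast_zmod_val i, ← ℓ_pow, hβ, zero_mul, map_zero, Pi.zero_apply]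

end Sequences

section TraceCharacter

variable {F : Type*} [Field F] [Algebra (ZMod 2) F]

/-- The additive character `x ↦ (-1) ^ Tr x` of a field of characteristic two. -/
noncomputable def traceChar (F : Type*) [Field F] [Algebra (ZMod 2) F] : AddChar F ℤ where
  toFun x := (-1) ^ (Algebra.trace (ZMod 2) F x).val
  map_zero_eq_one' := by simp
  map_add_eq_mul' x y := by
    have sign_add : ∀ a b : ZMod 2, (-1 : ℤ) ^ (a + b).val = (-1) ^ a.val * (-1) ^ b.val := by
      decide
    rw [map_add, sign_add]

lemma traceChar_apply (x : F) : traceChar F x = (-1) ^ (Algebra.trace (ZMod 2) F x).val := rfl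

lemma traceChar_eq_one_iff (x : F) : traceChar F x = 1 ↔ Algebra.trace (ZMod 2) F x = 0 := by
  have sign_eq_one_iff : ∀ a : ZMod 2, (-1 : ℤ) ^ a.val = 1 ↔ a = 0 := by decide
  rw [traceChar_apply, sign_eq_one_iff]

lemma traceChar_isPrimitive [Finite F] : (traceChar F).IsPrimitive := by
  intro a ha h
  refine ha ((traceForm_nondegenerate (ZMod 2) F).1 a fun b => ?_)
  rw [Algebra.traceForm_apply, ← traceChar_eq_one_iff]
  simpa [AddChar.mulShift_apply] using DFunLike.congr_fun h b

lemma traceChar_galois_apply {K : Type*} [Field K] [Algebra (ZMod 2) K] [Algebra K F]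
    [IsScalarTower (ZMod 2) K F] (g : Gal(F/K)) (x : F) :
    traceChar F (g x) = traceChar F x := by
  rw [traceChar_apply, traceChar_apply]
  congr 2
  exact Algebra.trace_eq_of_algEquiv (g.restrictScalars (ZMod 2)) x

end TraceCharacter

section PrimitiveElement

variable {F : Type*} [Field F] [Fintype F] {α : F}

lemma image_pow_eq_erase_zero [DecidableEq F] {N : ℕ} (hF : Fintype.card F = N + 1)
    (hα : IsPrimitiveRoot α N) : (range N).image (α ^ ·) = univ.erase 0 := by
  have N_pos : 0 < N := by have := Fintype.one_lt_card (α := F); omega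
  refine eq_of_subset_of_card_le ?_ ?_
  · intro x hx
    obtain ⟨i, -, rfl⟩ := mem_image.1 hx
    exact mem_erase.2 ⟨pow_ne_zero i (hα.ne_zero N_pos.ne'), mem_univ _⟩
  · rw [card_erase_of_mem (mem_univ _), card_univ, hF, card_image_of_injOn, card_range,
      Nat.add_sub_cancel]
    exact fun i hi j hj h => hα.pow_inj (mem_range.1 hi) (mem_range.1 hj) h

lemma exists_pow_eq_of_ne_zero {N : ℕ} (hF : Fintype.card F = N + 1) (hα : IsPrimitiveRoot α N)
    {x : F} (hx : x ≠ 0) : ∃ i, α ^ i = x := by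
  classical
  have mem_image_pow : x ∈ (range N).image (α ^ ·) := by
    simp [image_pow_eq_erase_zero hF hα, hx]
  obtain ⟨i, -, hi⟩ := mem_image.1 mem_image_pow
  exact ⟨i, hi⟩

lemma sum_eq_zero_add_sum_pow {M : Type*} [AddCommMonoid M] {N : ℕ}
    (hF : Fintype.card F = N + 1) (hα : IsPrimitiveRoot α N) (f : F → M) :
    ∑ x, f x = f 0 + ∑ i ∈ range N, f (α ^ i) := by
  classical
  rw [← add_sum_erase _ _ (mem_univ 0), ← image_pow_eq_erase_zero hF hα, sum_image]
  exact fun i hi j hj h => hα.pow_inj (mem_range.1 hi) (mem_range.1 hj) h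

end PrimitiveElement

lemma IsGoldFamily.mul_apply_surjective {K F ι : Type*} [Field K] [Field F] [Finite F]
    [Algebra K F] [Fintype ι] [CharP F 2] {ρ : Gal(F/K)} {J : ι → Gal(F/K)}
    (hJ : IsGoldFamily ρ J) (j : ι) : Function.Surjective fun x => x * J j x := by
  refine Finite.surjective_of_injective (mul_galois_injective (hJ.odd_finrank.of_dvd_nat ?_))
  rw [← IsGalois.card_aut_eq_finrank]
  exact orderOf_dvd_natCard (J j)

section Code

variable {K F ι : Type*} [Field K] [Field F] [Algebra (ZMod 2) F] [Algebra K F] [Fintype ι]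

/-- The sequence `i ↦ Tr (phase J b₀ b (α ^ i))` attached to the coefficients `(b₀, b)`. When `α`
is primitive and `J` is a Gold family, this parametrizes the code generated by the shifts of
`i ↦ Tr (α ^ i)` and of its decimations. -/
noncomputable def encode (m : ℕ) (J : ι → Gal(F/K)) (α : F) :
    F × (ι → F) →ₗ[ZMod 2] BinSeq m where
  toFun p i := Algebra.trace (ZMod 2) F (phase J p.1 p.2 (α ^ i.val))
  map_add' p p' := by
    funext i
    rw [Pi.add_apply, ← map_add]
    congr 1
    simp only [phase, Prod.fst_add, Prod.snd_add, Pi.add_apply, add_mul, sum_add_distrib]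
    ring
  map_smul' c p := by
    funext i
    rw [Pi.smul_apply, RingHom.id_apply, ← map_smul]
    congr 1
    simp only [phase, Prod.smul_fst, Prod.smul_snd, Pi.smul_apply, smul_mul_assoc, smul_add,
      smul_sum]

variable {m : ℕ} {J : ι → Gal(F/K)} {α : F}

lemma encode_natCast (hα : α ^ (2 ^ m - 1) = 1) (p : F × (ι → F)) (i : ℕ) :
    encode m J α p i = Algebra.trace (ZMod 2) F (phase J p.1 p.2 (α ^ i)) := by
  change Algebra.trace (ZMod 2) F (phase J p.1 p.2 (α ^ (i : ZMod (2 ^ m - 1)).val)) = _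
  rw [ZMod.val_natCast, ← pow_eq_pow_mod i hα]

lemma shift_eq_encode {s : BinSeq m} {β : F} (hα : α ^ (2 ^ m - 1) = 1) [NeZero (2 ^ m - 1)]
    (hs : ∀ i : ℕ, s i = Algebra.trace (ZMod 2) F (β * α ^ i)) (t : ℕ) :
    shift t s = encode m J α (β * α ^ t, 0) := by
  funext i
  obtain ⟨i, rfl⟩ := ZMod.natCast_zmod_surjective i
  rw [shift, ← Nat.cast_add, hs, encode_natCast hα, phase]
  simp only [Pi.zero_apply, zero_mul, sum_const_zero, add_zero]
  ring_nf

lemma shift_decimate_eq_encode [DecidableEq ι] {s : BinSeq m} {β : F} (hα : α ^ (2 ^ m - 1) = 1)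
    [NeZero (2 ^ m - 1)] (hs : ∀ i : ℕ, s i = Algebra.trace (ZMod 2) F (β * α ^ i)) {j : ι} {f : ℕ}
    (hf : ∀ x, x * J j x = x ^ f) (t : ℕ) :
    shift t (decimate f s) = encode m J α (0, Pi.single j (β * (α ^ t) ^ f)) := by
  funext i
  obtain ⟨i, rfl⟩ := ZMod.natCast_zmod_surjective i
  rw [shift, decimate, ← Nat.cast_add, ← Nat.cast_mul, hs, encode_natCast hα, phase]
  dsimp only
  rw [Fintype.sum_eq_single j fun l hl => by rw [Pi.single_eq_of_ne hl, zero_mul],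
    Pi.single_eq_same, hf]
  ring_nf

variable [Fintype F]

lemma dc_encode (hF : Fintype.card F = 2 ^ m) (hα : IsPrimitiveRoot α (2 ^ m - 1))
    (p : F × (ι → F)) : dc (encode m J α p) = expSum (traceChar F) J p.1 p.2 - 1 := by
  have card_eq : Fintype.card F = 2 ^ m - 1 + 1 :=
    hF.trans (Nat.sub_add_cancel Nat.one_le_two_pow).symm
  have phase_zero : traceChar F (phase J p.1 p.2 0) = 1 := by simp [phase]
  rw [expSum, sum_eq_zero_add_sum_pow card_eq hα, phase_zero, add_sub_cancel_left, dc]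
  simp_rw [encode_natCast hα.pow_eq_one, traceChar_apply]

lemma encode_injective [Algebra (ZMod 2) K] [IsScalarTower (ZMod 2) K F] [CharP F 2]
    {ρ : Gal(F/K)} (hJ : IsGoldFamily ρ J) (hF : Fintype.card F = 2 ^ m)
    (hα : IsPrimitiveRoot α (2 ^ m - 1)) : Function.Injective (encode m J α) := by
  have card_eq : Fintype.card F = 2 ^ m - 1 + 1 :=
    hF.trans (Nat.sub_add_cancel Nat.one_le_two_pow).symm
  rw [injective_iff_map_eq_zero]
  rintro ⟨b₀, b⟩ h
  have traceChar_phase (x : F) : traceChar F (phase J b₀ b x) = 1 := by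
    rcases eq_or_ne x 0 with rfl | hx
    · simp [phase]
    · obtain ⟨i, rfl⟩ := exists_pow_eq_of_ne_zero card_eq hα hx
      rw [traceChar_eq_one_iff, ← encode_natCast hα.pow_eq_one (b₀, b), h, Pi.zero_apply]
  obtain ⟨rfl, rfl⟩ := eq_zero_of_forall_addChar_phase_eq_one hJ traceChar_isPrimitive
    traceChar_galois_apply traceChar_phase
  rfl

lemma code_eq_range_encode [CharP F 2] {d e k : ℕ} {S : System} {s : BinSeq m} {β : F}
    {ρ : Gal(F/K)} {J : Fin (k - 1) → Gal(F/K)} (hJ : IsGoldFamily ρ J)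
    (hJS : ∀ i x, x * J i x = x ^ S.factor m d e (i + 1)) (hF : Fintype.card F = 2 ^ m)
    (hα : IsPrimitiveRoot α (2 ^ m - 1)) (hβ : β ≠ 0)
    (hs : ∀ i : ℕ, s i = Algebra.trace (ZMod 2) F (β * α ^ i)) :
    code m d e k S s = LinearMap.range (encode m J α) := by
  have card_eq : Fintype.card F = 2 ^ m - 1 + 1 :=
    hF.trans (Nat.sub_add_cancel Nat.one_le_two_pow).symm
  have : NeZero (2 ^ m - 1) := ⟨by have := Fintype.one_lt_card (α := F); omega⟩
  apply le_antisymm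
  · refine Submodule.span_le.2 ?_
    rintro c (⟨t, rfl⟩ | ⟨t, j, one_le_j, j_le, rfl⟩) <;>
      obtain ⟨t, rfl⟩ := ZMod.natCast_zmod_surjective t
    · exact ⟨_, (shift_eq_encode hα.pow_eq_one hs t).symm⟩
    · refine ⟨_, (shift_decimate_eq_encode hα.pow_eq_one hs (j := ⟨j - 1, by omega⟩) ?_ t).symm⟩
      simpa only [Nat.sub_add_cancel one_le_j] using hJS ⟨j - 1, by omega⟩
  · rintro _ ⟨⟨b₀, b⟩, rfl⟩
    have decomposition : (b₀, b) = (b₀, 0) + ∑ j, (0, Pi.single j (b j)) := by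
      ext j <;> simp [Prod.fst_sum, Prod.snd_sum]
    rw [decomposition, map_add, map_sum]
    refine Submodule.add_mem _ ?_ (Submodule.sum_mem _ fun j _ => ?_)
    · rcases eq_or_ne b₀ 0 with rfl | hb₀
      · exact (encode m J α).map_zero ▸ Submodule.zero_mem _
      · obtain ⟨t, ht⟩ := exists_pow_eq_of_ne_zero card_eq hα (div_ne_zero hb₀ hβ)
        rw [← mul_div_cancel₀ b₀ hβ, ← ht, ← shift_eq_encode hα.pow_eq_one hs]
        exact Submodule.subset_span (Or.inl ⟨_, rfl⟩)
    · rcases eq_or_ne (b j) 0 with hb | hb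
      · rw [hb, Pi.single_zero]
        exact (encode m J α).map_zero ▸ Submodule.zero_mem _
      · obtain ⟨y, hy : y * J j y = b j / β⟩ := hJ.mul_apply_surjective j (b j / β)
        have y_ne_zero : y ≠ 0 := by
          rintro rfl
          exact div_ne_zero hb hβ (by simpa using hy.symm)
        obtain ⟨t, rfl⟩ := exists_pow_eq_of_ne_zero card_eq hα y_ne_zero
        rw [← mul_div_cancel₀ (b j) hβ, ← hy, hJS,
          ← shift_decimate_eq_encode hα.pow_eq_one hs (hJS j)]
        exact Submodule.subset_span (Or.inr ⟨_, j + 1, by omega, by omega, rfl⟩)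

lemma ncard_balanced_eq_card_expSum_eq_zero [Algebra (ZMod 2) K] [IsScalarTower (ZMod 2) K F]
    [DecidableEq ι] [CharP F 2] {ρ : Gal(F/K)} (hJ : IsGoldFamily ρ J)
    (hF : Fintype.card F = 2 ^ m) (hα : IsPrimitiveRoot α (2 ^ m - 1)) :
    {c | c ∈ LinearMap.range (encode m J α) ∧ dc c = -1}.ncard =
      #{p : F × (ι → F) | expSum (traceChar F) J p.1 p.2 = 0} := by
  rw [← Set.ncard_coe_finset, ← Set.ncard_image_of_injective _ (encode_injective hJ hF hα)]
  congr 1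
  ext c
  simp only [coe_filter, mem_univ, true_and, Set.mem_image, Set.mem_ofPred_eq]
  constructor
  · rintro ⟨⟨p, rfl⟩, hp⟩
    rw [dc_encode hF hα] at hp
    exact ⟨p, by omega, rfl⟩
  · rintro ⟨p, hp, rfl⟩
    exact ⟨⟨p, rfl⟩, by rw [dc_encode hF hα, hp, zero_sub]⟩

end Code

/-- The number of balanced words predicted for a code of dimension `k` over a field with `X`
elements whose Gold family has a base field with `q` elements. -/
noncomputable def balancedFormula (q X : ℝ) (k : ℕ) : ℝ :=
  X ^ k - 1 - ∑ u ∈ range (k - 1), (-1) ^ u * (q ^ ((u + 1) ^ 2))⁻¹ * (X ^ (k - u) - X) *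
    ∏ j ∈ range u, (X - q ^ (2 * j + 1))

lemma balancedCount_eq {m d e k : ℕ} (h : Parameters m d e k) (S : System) {s : BinSeq m}
    (hs : IsMaxLength m s) :
    (balancedCount m d e k S s : ℝ) = balancedFormula (2 ^ e) (2 ^ m) k := by
  have two_le_m : 2 ≤ m := by
    obtain ⟨t, hm, hkt, e_pos, -⟩ := h.exists_odd
    have two_le_k := h.two_le
    rw [hm]
    nlinarith
  obtain ⟨F, _, _, _, α, β, card_F, hα, hβ, hsα⟩ := exists_trace_representation two_le_m hs
  obtain ⟨K, ρ, J, card_K, hJ, hJS⟩ := exists_isGoldFamily h card_F S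
  have := Fintype.ofFinite F
  have := Fintype.ofFinite K
  have : CharP F 2 := charP_of_injective_algebraMap (algebraMap (ZMod 2) F).injective 2
  rw [Nat.card_eq_fintype_card] at card_F card_K
  rw [balancedCount, code_eq_range_encode hJ hJS card_F hα hβ hsα,
    ncard_balanced_eq_card_expSum_eq_zero hJ card_F hα,
    card_expSum_eq_zero hJ traceChar_isPrimitive traceChar_galois_apply, card_F, card_K,
    Fintype.card_fin, Nat.sub_add_cancel (by linarith [h.two_le])]
  push_cast
  rfl

section Asymptotics

lemma one_sub_sum_le_prod_one_sub {ι : Type*} {s : Finset ι} {f : ι → ℝ} (hf₀ : ∀ i ∈ s, 0 ≤ f i)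
    (hf₁ : ∀ i ∈ s, f i ≤ 1) : 1 - ∑ i ∈ s, f i ≤ ∏ i ∈ s, (1 - f i) := by
  induction s using Finset.cons_induction with
  | empty => simp
  | cons a s ha ih =>
    rw [forall_mem_cons] at hf₀ hf₁
    have prod_le : ∏ i ∈ s, (1 - f i) ≤ 1 := prod_le_one
      (fun i hi => sub_nonneg.2 (hf₁.2 i hi)) fun i hi => sub_le_self _ (hf₀.2 i hi)
    rw [sum_cons, prod_cons]
    nlinarith [ih hf₀.2 hf₁.2, mul_le_of_le_one_right hf₀.1 prod_le]

variable {q X : ℝ}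

lemma sum_pow_odd_le (hq : 2 ≤ q) (u : ℕ) : ∑ j ∈ range u, q ^ (2 * j + 1) ≤ q ^ (2 * u) := by
  induction u with
  | zero => simp
  | succ u ih =>
    have : 1 + q ≤ q ^ 2 := by nlinarith
    calc ∑ j ∈ range (u + 1), q ^ (2 * j + 1) ≤ q ^ (2 * u) + q ^ (2 * u + 1) := by
          rw [sum_range_succ]; gcongr
      _ = q ^ (2 * u) * (1 + q) := by ring
      _ ≤ q ^ (2 * u) * q ^ 2 := by gcongr
      _ = q ^ (2 * (u + 1)) := by ring

lemma one_sub_mul_prod_bounds (hq : 2 ≤ q) (hX : 1 ≤ X) {u n : ℕ} (hn : n ≠ 0)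
    (hqX : ∀ j < u, q ^ (2 * j + 1) ≤ X) :
    0 ≤ 1 - (1 - (X ^ n)⁻¹) * ∏ j ∈ range u, (1 - q ^ (2 * j + 1) / X) ∧
      1 - (1 - (X ^ n)⁻¹) * ∏ j ∈ range u, (1 - q ^ (2 * j + 1) / X) ≤ 2 * q ^ (2 * u) / X := by
  have : 0 < q := by linarith
  have X_pos : 0 < X := by linarith
  have factor_nonneg : ∀ j ∈ range u, 0 ≤ q ^ (2 * j + 1) / X := fun j _ => by positivity
  have factor_le_one : ∀ j ∈ range u, q ^ (2 * j + 1) / X ≤ 1 := fun j hj =>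
    (div_le_one X_pos).2 (hqX j (mem_range.1 hj))
  have prod_nonneg : 0 ≤ ∏ j ∈ range u, (1 - q ^ (2 * j + 1) / X) :=
    Finset.prod_nonneg fun j hj => sub_nonneg.2 (factor_le_one j hj)
  have prod_le_one : ∏ j ∈ range u, (1 - q ^ (2 * j + 1) / X) ≤ 1 :=
    Finset.prod_le_one (fun j hj => sub_nonneg.2 (factor_le_one j hj)) fun j hj =>
      sub_le_self _ (factor_nonneg j hj)
  have le_prod : 1 - q ^ (2 * u) / X ≤ ∏ j ∈ range u, (1 - q ^ (2 * j + 1) / X) := by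
    refine le_trans ?_ (one_sub_sum_le_prod_one_sub factor_nonneg factor_le_one)
    rw [← sum_div]
    gcongr
    exact sum_pow_odd_le hq u
  have inv_nonneg : 0 ≤ (X ^ n)⁻¹ := by positivity
  have inv_le : (X ^ n)⁻¹ ≤ q ^ (2 * u) / X := by
    rw [← one_div]
    exact div_le_div₀ (by positivity) (one_le_pow₀ (by linarith)) X_pos (le_self_pow₀ hX hn)
  constructor
  · nlinarith
  · rw [two_mul, add_div]
    nlinarith

lemma inv_pow_le_half_pow (hq : 2 ≤ q) {n N : ℕ} (h : n ≤ N) : (q ^ N)⁻¹ ≤ (1 / 2) ^ n := by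
  rw [one_div, inv_pow]
  gcongr
  calc (2 : ℝ) ^ n ≤ 2 ^ N := by gcongr; norm_num
    _ ≤ q ^ N := by gcongr

/-- The limit of the proportion of balanced words, as the field grows and `q` and `k` are fixed. -/
noncomputable def balancedDensity (q : ℝ) (k : ℕ) : ℝ :=
  1 - ∑ u ∈ range (k - 1), (-1) ^ u * (q ^ ((u + 1) ^ 2))⁻¹

lemma one_third_le_balancedDensity (hq : 2 ≤ q) (k : ℕ) : 1 / 3 ≤ balancedDensity q k := by
  have term_le (u : ℕ) : (-1) ^ u * (q ^ ((u + 1) ^ 2))⁻¹ ≤ 1 / 2 * (1 / 4 : ℝ) ^ u := by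
    calc (-1) ^ u * (q ^ ((u + 1) ^ 2))⁻¹ ≤ (q ^ ((u + 1) ^ 2))⁻¹ :=
          mul_le_of_le_one_left (by positivity) ((le_abs_self _).trans_eq (abs_neg_one_pow u))
      _ ≤ (1 / 2) ^ (2 * u + 1) := inv_pow_le_half_pow hq (by nlinarith)
      _ = 1 / 2 * (1 / 4 : ℝ) ^ u := by rw [pow_succ, pow_mul]; norm_num [mul_comm]
  have sum_le : ∑ u ∈ range (k - 1), (-1) ^ u * (q ^ ((u + 1) ^ 2))⁻¹ ≤ 2 / 3 :=
    calc ∑ u ∈ range (k - 1), (-1) ^ u * (q ^ ((u + 1) ^ 2))⁻¹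
        ≤ 1 / 2 * ∑ u ∈ range (k - 1), (1 / 4 : ℝ) ^ u := by
          rw [mul_sum]; exact sum_le_sum fun u _ => term_le u
      _ ≤ 1 / 2 * (1 - 1 / 4)⁻¹ := by
          gcongr
          rw [← tsum_geometric_of_lt_one (by norm_num) (by norm_num)]
          exact (summable_geometric_of_lt_one (by norm_num) (by norm_num)).sum_le_tsum _
            fun u _ => by positivity
      _ = 2 / 3 := by norm_num
  rw [balancedDensity]
  linarith

lemma balancedFormula_div_sub_density (hX : X ≠ 0) (q : ℝ) (k : ℕ) :
    balancedFormula q X k / X ^ k - balancedDensity q k = -(X ^ k)⁻¹ +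
      ∑ u ∈ range (k - 1), (-1) ^ u * (q ^ ((u + 1) ^ 2))⁻¹ *
        (1 - (1 - (X ^ (k - 1 - u))⁻¹) * ∏ j ∈ range u, (1 - q ^ (2 * j + 1) / X)) := by
  have term_eq : ∀ u ∈ range (k - 1), (-1) ^ u * (q ^ ((u + 1) ^ 2))⁻¹ *
      (1 - (1 - (X ^ (k - 1 - u))⁻¹) * ∏ j ∈ range u, (1 - q ^ (2 * j + 1) / X)) =
      (-1) ^ u * (q ^ ((u + 1) ^ 2))⁻¹ - ((-1) ^ u * (q ^ ((u + 1) ^ 2))⁻¹ *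
        (X ^ (k - u) - X) * ∏ j ∈ range u, (X - q ^ (2 * j + 1))) / X ^ k := by
    intro u hu
    have u_lt := mem_range.1 hu
    have prod_eq : ∏ j ∈ range u, (X - q ^ (2 * j + 1)) =
        X ^ u * ∏ j ∈ range u, (1 - q ^ (2 * j + 1) / X) := by
      rw [pow_eq_prod_const, ← prod_mul_distrib]
      exact prod_congr rfl fun j _ => by field_simp
    obtain ⟨n, rfl⟩ : ∃ n, k = u + n + 1 := ⟨k - 1 - u, by omega⟩
    rw [prod_eq, show u + n + 1 - 1 - u = n by omega, show u + n + 1 - u = n + 1 by omega]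
    field_simp
    ring
  rw [sum_congr rfl term_eq, sum_sub_distrib, ← sum_div, balancedFormula, balancedDensity, sub_div,
    sub_div, div_self (pow_ne_zero k hX)]
  ring

lemma abs_balancedFormula_div_sub_density_le (hq : 2 ≤ q) (hX : 1 ≤ X) {k : ℕ} (hk : k ≠ 0)
    (hqX : ∀ j < k - 2, q ^ (2 * j + 1) ≤ X) :
    |balancedFormula q X k / X ^ k - balancedDensity q k| ≤ 3 / X := by
  have : 0 < q := by linarith
  have X_pos : 0 < X := by linarith
  have first_le : |(-(X ^ k)⁻¹)| ≤ 1 / X := by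
    rw [abs_neg, abs_of_pos (by positivity), one_div]
    gcongr
    exact le_self_pow₀ hX hk
  have term_le : ∀ u ∈ range (k - 1), |(-1) ^ u * (q ^ ((u + 1) ^ 2))⁻¹ *
      (1 - (1 - (X ^ (k - 1 - u))⁻¹) * ∏ j ∈ range u, (1 - q ^ (2 * j + 1) / X))| ≤
      (1 / 2) ^ u / X := by
    intro u hu
    have u_lt := mem_range.1 hu
    obtain ⟨defect_nonneg, defect_le⟩ := one_sub_mul_prod_bounds hq hX
      (by omega : k - 1 - u ≠ 0) (u := u) fun j hj => hqX j (by omega)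
    rw [abs_mul, abs_mul, abs_neg_one_pow, one_mul, abs_of_pos (by positivity),
      abs_of_nonneg defect_nonneg]
    calc _ ≤ (q ^ ((u + 1) ^ 2))⁻¹ * (2 * q ^ (2 * u) / X) := by gcongr
      _ = 2 * (q ^ (u ^ 2 + 1))⁻¹ / X := by
        rw [show (u + 1) ^ 2 = 2 * u + (u ^ 2 + 1) by ring, pow_add]
        field_simp
      _ ≤ 2 * (1 / 2) ^ (u + 1) / X := by
        gcongr
        exact inv_pow_le_half_pow hq (by nlinarith)
      _ = (1 / 2) ^ u / X := by rw [pow_succ]; ring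
  rw [balancedFormula_div_sub_density X_pos.ne']
  calc _ ≤ 1 / X + ∑ u ∈ range (k - 1), (1 / 2) ^ u / X :=
        (abs_add_le _ _).trans
          (add_le_add first_le ((abs_sum_le_sum_abs _ _).trans (sum_le_sum term_le)))
    _ ≤ 1 / X + 2 / X := by
        rw [← sum_div]
        gcongr
        exact sum_geometric_two_le _
    _ = 3 / X := by ring

lemma abs_balancedFormula_div_sub_one_le (hq : 2 ≤ q) (hX : 1 ≤ X) {k : ℕ} (hk : k ≠ 0)
    (hqX : ∀ j < k - 2, q ^ (2 * j + 1) ≤ X) :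
    |balancedFormula q X k / (X ^ k * balancedDensity q k) - 1| ≤ 9 / X := by
  have density_ge := one_third_le_balancedDensity hq k
  have density_pos : 0 < balancedDensity q k := by linarith
  rw [← div_div, div_sub_one density_pos.ne', abs_div, abs_of_pos density_pos,
    div_le_iff₀ density_pos]
  calc _ ≤ 3 / X := abs_balancedFormula_div_sub_density_le hq hX hk hqX
    _ = 9 / X * (1 / 3) := by ring
    _ ≤ 9 / X * balancedDensity q k := by gcongr

end Asymptotics

lemma Parameters.pow_odd_le {m d e k j : ℕ} (h : Parameters m d e k) (hj : j < k - 2) :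
    ((2 : ℝ) ^ e) ^ (2 * j + 1) ≤ 2 ^ m := by
  obtain ⟨t, hm, hkt, -, -⟩ := h.exists_odd
  rw [← pow_mul, hm]
  gcongr
  · norm_num
  · omega

lemma abs_balancedCount_div_sub_one_le {m d e k : ℕ} (h : Parameters m d e k) (S : System)
    {s : BinSeq m} (hs : IsMaxLength m s) :
    |(balancedCount m d e k S s : ℝ) / ((2 ^ m) ^ k * balancedDensity (2 ^ e) k) - 1| ≤
      9 / 2 ^ m := by
  obtain ⟨-, -, -, e_pos, -⟩ := h.exists_odd
  have two_le_k := h.two_le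
  rw [balancedCount_eq h S hs]
  exact abs_balancedFormula_div_sub_one_le (le_self_pow₀ one_le_two e_pos.ne')
    (one_le_pow₀ one_le_two) (by omega) fun j => h.pow_odd_le

end GoldType

theorem theorem1p3 :
    (∀ (m d e k : ℕ), GoldType.Parameters m d e k →
      ∀ (S : GoldType.System) (s : GoldType.BinSeq m), GoldType.IsMaxLength m s →
        (GoldType.balancedCount m d e k S s : ℝ) =
          2 ^ (m * k) - 1 -
            ∑ u ∈ Finset.range (k - 1),
              (-1 : ℝ) ^ u * (2 : ℝ) ^ (-((e * (u + 1) ^ 2 : ℕ) : ℤ)) *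
                ((2 : ℝ) ^ (m * (k - u)) - 2 ^ m) *
                ∏ j ∈ Finset.range u, ((2 : ℝ) ^ m - 2 ^ (e * (2 * j + 1)))) ∧
    (∀ ε : ℝ, 0 < ε → ∃ m₀ : ℕ, ∀ (m d e k : ℕ), m₀ ≤ m → GoldType.Parameters m d e k →
      ∀ (S : GoldType.System) (s : GoldType.BinSeq m), GoldType.IsMaxLength m s →
        |(GoldType.balancedCount m d e k S s : ℝ) /
            (2 ^ (m * k) *
              (1 - ∑ u ∈ Finset.range (k - 1),
                (-1 : ℝ) ^ u * (2 : ℝ) ^ (-((e * (u + 1) ^ 2 : ℕ) : ℤ)))) - 1| ≤ ε) := by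
  have zpow_eq (e u : ℕ) : (2 : ℝ) ^ (-((e * (u + 1) ^ 2 : ℕ) : ℤ)) =
      (((2 : ℝ) ^ e) ^ ((u + 1) ^ 2))⁻¹ := by
    rw [zpow_neg, zpow_natCast, pow_mul]
  simp only [zpow_eq, pow_mul]
  refine ⟨fun m d e k h S s hs => GoldType.balancedCount_eq h S hs, fun ε hε => ?_⟩
  obtain ⟨m₀, le_m₀⟩ := exists_nat_ge (9 / ε)
  refine ⟨m₀, fun m d e k hm h S s hs => ?_⟩
  have le_two_pow : 9 / ε ≤ 2 ^ m := calc
    9 / ε ≤ m := le_m₀.trans (Nat.cast_le.2 hm)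
    _ ≤ 2 ^ m := mod_cast (Nat.lt_two_pow_self (n := m)).le
  exact (GoldType.abs_balancedCount_div_sub_one_le h S hs).trans
    ((div_le_comm₀ (by positivity) hε).2 le_two_pow)
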